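/- **Theorem 1.2.** Let $\Lambda\subset\mathbb R^d$ be a full-dimensional lattice (discrete subgroup spanning $\mathbb R^d$) with dual lattice $\Lambda^\star=\{y\in\mathbb R^d : x\cdot y\in\mathbb Z\ \forall x\in\Lambda\}$. A convex body is a compact convex set with non-empty interior. The lattice width of a convex body $C\subset\mathbb R^d$ is $$\mathrm{width}_\Lambda(C)=\min_{y\in\Lambda^\star\setminus\{0\}}\ \max_{a,b\in C} y\cdot(a-b).$$ A non-degenerate segment $[a,b]$ is a lattice segment if $b-a\in\mathrm{span}\{x\}$ for some $x\in\Lambda$; its lattice length is $|b-a|/|v|$, where $v\in\Lambda$ is the positive multiple of $b-a$ that generates $\Lambda\cap\mathrm{span}\{b-a\}$. The lattice diameter $\mathrm{diam}_\Lambda(C)$ is the maximal lattice length of a lattice segment contained in $C$. A convex body $C$ is lattice reduced with respect to $\Lambda$ if there is no convex body $C'\subsetneq C$ with $\mathrm{width}_\Lambda(C')=\mathrm{width}_\Lambda(C)$, and lattice complete with respect to $\Lambda$ if there is no convex body $C'\supsetneq C$ with $\mathrm{diam}_\Lambda(C')=\mathrm{diam}_\Lambda(C)$. There is a universal constant $c>0$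 such that for every $d\ge 1$, every full-dimensional lattice $\Lambda\subset\mathbb R^d$ and every convex body $C\subset\mathbb R^d$: 1. If $C$ is lattice reduced with respect to $\Lambda$, then the non-zero vectors $y\in\Lambda^\star$ that realize the minimum $\mathrm{width}_\Lambda(C)$ span a linear space of dimension at least $c\log d$. 2. If $C$ is lattice complete with respect to $\Lambda$, then the non-zero vectors $v\in\Lambda$ for which there is a lattice segment in $C$ parallel to $v$ achieving $\mathrm{diam}_\Lambda(C)$ span a linear space of dimension at least $c\log d$. In both statements the order of magnitude $\log d$ is best possible: there is a universal constant $K>0$ such that for every $d\ge 2$ and every full-dimensional lattice $\Lambda\subset\mathbb R^d$ there is a lattice reduced (respectively lattice complete) convex body with respect to $\Lambda$ for which the linear space in 1 (respectively 2) has dimension at most $K\log d$. -/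

import Mathlib

namespace LatticeBodies

variable {E : Type*} [NormedAddCommGroup E] [InnerProductSpace ℝ E]

/-- A convex body: a compact convex set with non-empty interior. -/
structure IsConvexBody (C : Set E) : Prop where
  convex : Convex ℝ C
  isCompact : IsCompact C
  interior_nonempty : (interior C).Nonempty

/-- The dual lattice `{y : x · y ∈ ℤ for all x ∈ Λ}`. -/
noncomputable def dualLattice (Λ : Submodule ℤ E) : Submodule ℤ E :=
  LinearMap.BilinForm.dualSubmodule (innerₗ E) Λ

theorem mem_dualLattice {Λ : Submodule ℤ E} {y : E} :
    y ∈ dualLattice Λ ↔ ∀ x ∈ Λ, ∃ n : ℤ, inner ℝ x y = (n : ℝ) := by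
  rw [dualLattice, LinearMap.BilinForm.mem_dualSubmodule]
  simp only [Submodule.mem_one, innerₗ_apply_apply, algebraMap_int_eq, eq_intCast]
  refine forall₂_congr fun x _ => exists_congr fun n => ?_
  rw [real_inner_comm]
  exact eq_comm

/-- The width `max_{a, b ∈ C} y · (a - b)` of `C` in direction `y`. -/
noncomputable def widthAlong (C : Set E) (y : E) : ℝ :=
  sSup {r : ℝ | ∃ a ∈ C, ∃ b ∈ C, r = inner ℝ y (a - b)}

/-- The lattice width of `C`: the minimum of `widthAlong C y` over the non-zero `y ∈ Λ⋆`. -/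
noncomputable def latticeWidth (Λ : Submodule ℤ E) (C : Set E) : ℝ :=
  sInf {r : ℝ | ∃ y ∈ dualLattice Λ, y ≠ 0 ∧ r = widthAlong C y}

/-- The non-zero vectors of the dual lattice that realize the lattice width of `C`. -/
def widthDirections (Λ : Submodule ℤ E) (C : Set E) : Set E :=
  {y | y ∈ dualLattice Λ ∧ y ≠ 0 ∧ widthAlong C y = latticeWidth Λ C}

/-- `v` is the primitive direction in `Λ` of the non-degenerate segment `[a, b]`: a positive
multiple of `b - a` that generates the group `Λ ∩ span {b - a}`.
Such a `v` exists (and is then unique) exactly when `[a, b]` is a lattice segment. -/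
structure IsPrimitiveDirection (Λ : Submodule ℤ E) (a b v : E) : Prop where
  ne : a ≠ b
  pos_multiple : ∃ t : ℝ, 0 < t ∧ v = t • (b - a)
  generates : Λ ⊓ (Submodule.span ℝ {b - a}).restrictScalars ℤ = Submodule.span ℤ {v}

/-- `ℓ` is the lattice length `|b - a| / |v|` of the (non-degenerate) lattice segment `[a, b]`,
where `v` is its primitive direction. -/
def HasLatticeLength (Λ : Submodule ℤ E) (a b : E) (ℓ : ℝ) : Prop :=
  ∃ v, IsPrimitiveDirection Λ a b v ∧ ℓ = ‖b - a‖ / ‖v‖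

/-- The lattice diameter of `C`: the maximal lattice length of a lattice segment in `C`. -/
noncomputable def latticeDiam (Λ : Submodule ℤ E) (C : Set E) : ℝ :=
  sSup {ℓ : ℝ | ∃ a b : E, segment ℝ a b ⊆ C ∧ HasLatticeLength Λ a b ℓ}

/-- The non-zero lattice vectors `w` such that some lattice segment in `C` parallel to `w`
achieves the lattice diameter of `C`. -/
def diamDirections (Λ : Submodule ℤ E) (C : Set E) : Set E :=
  {w | w ∈ Λ ∧ w ≠ 0 ∧ ∃ a b : E, segment ℝ a b ⊆ C ∧ w ∈ Submodule.span ℝ {b - a} ∧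
    HasLatticeLength Λ a b (latticeDiam Λ C)}

/-- `C` is a lattice reduced convex body: no convex body properly contained in `C` has the same
lattice width. -/
def IsLatticeReduced (Λ : Submodule ℤ E) (C : Set E) : Prop :=
  IsConvexBody C ∧ ¬ ∃ C' : Set E, IsConvexBody C' ∧ C' ⊂ C ∧ latticeWidth Λ C' = latticeWidth Λ C

/-- `C` is a lattice complete convex body: no convex body properly containing `C` has the same
lattice diameter. -/
def IsLatticeComplete (Λ : Submodule ℤ E) (C : Set E) : Prop :=
  IsConvexBody C ∧ ¬ ∃ C' : Set E, IsConvexBody C' ∧ C ⊂ C' ∧ latticeDiam Λ C' = latticeDiam Λ C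

end LatticeBodies

namespace LatticeBodies

open Module Submodule Set Filter Topology
open scoped Pointwise

/-! ### Discrete subgroups, lattice length and diameter, directional width. -/

section Basic

/-! Lower bounds. Two distinct extremal directions are never congruent modulo 3: if `v - w = 3u`
with `u ≠ 0`, the width along `u` is at most 2/3 of the minimum, or, dually, `C - C` contains `u`
scaled by 3/2 of the diameter. Hence there are at most `3 ^ k` extremal directions when they span
dimension `k` (`finite_and_ncard_le_three_pow`). If `3 ^ k < d`, some `e ≠ 0` is orthogonal to one
chosen vector per direction: a support point of `C` in the reduced case, a normal of `C - C` in the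
complete case. Then `C` can be shrunk towards the hull of the support points, or extended along `e`,
without disturbing any extremal direction; non-extremal directions leave a positive gap, since only
finitely many lattice vectors matter. So `d ≤ 3 ^ k`.

Optimality. It is enough to find a polytope norm `max |⟪p j, ·⟫|` that is at least 1 on nonzero
lattice vectors and has a lattice point in the relative interior of every facet of its unit ball
(`IsFacetSystem`). For the dual lattice, the hull of `± p j` is reduced; for the lattice itself, the
unit ball is complete. In both cases extremal directions come from lattice points of the unit ball.
In `exists_isFacetSystem` these all lie in the span of about `log₂ d` basis vectors. On that
coordinate block of size `k` the functionals `avgDiff S`, one per nonempty `S`, form such a system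
of `2 ^ k - 1` functionals. Each remaining coordinate is added, with a large weight, to its own
functional: this bounds that coordinate below 1 on the unit ball without changing anything on the
block. -/

theorem exists_pos_forall_norm_lt_imp_eq_zero {F : Type*} [NormedAddCommGroup F]
    (L : Submodule ℤ F) [DiscreteTopology L] :
    ∃ r > 0, ∀ x ∈ L, ‖x‖ < r → x = 0 := by
  obtain ⟨r, hr, h⟩ := Metric.isOpen_iff.1 (isOpen_discrete ({0} : Set L)) 0 rfl
  refine ⟨r, hr, fun x hx hxr => ?_⟩
  have : (⟨x, hx⟩ : L) ∈ Metric.ball (0 : L) r := by simpa using hxr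
  exact congrArg Subtype.val (h this)

variable {E : Type*} [NormedAddCommGroup E] [InnerProductSpace ℝ E]

/-- Lattice vectors that are pairwise incongruent modulo three are at most `3 ^ k` in number, where
`k` is the dimension of their span. -/
theorem finite_and_ncard_le_three_pow [FiniteDimensional ℝ E] (L : Submodule ℤ E)
    [DiscreteTopology L] {s : Set E} (hsL : s ⊆ L)
    (h : ∀ v ∈ s, ∀ w ∈ s, ∀ u ∈ L, v - w = (3 : ℝ) • u → u = 0) :
    s.Finite ∧ s.ncard ≤ 3 ^ finrank ℝ (span ℝ s) := by
  -- Intersecting `L` with the real span makes the ℤ-rank equal to the real dimension; reducing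
  -- coordinates modulo 3 then maps `s` to `(ZMod 3) ^ k`.
  let M : Submodule ℤ E := L ⊓ (span ℝ s).restrictScalars ℤ
  have hM : DiscreteTopology M :=
    DiscreteTopology.of_subset (inferInstanceAs (DiscreteTopology (L : Set E))) fun x hx => hx.1
  have hspan : span ℝ (M : Set E) = span ℝ s :=
    le_antisymm (span_le.2 fun x hx => hx.2) (span_mono fun x hx => ⟨hsL hx, subset_span hx⟩)
  have hrank : finrank ℤ M = finrank ℝ (span ℝ s) := by
    have := Real.finrank_eq_int_finrank_of_discrete (s := (M : Set E))
      (by rw [Submodule.span_eq]; exact hM)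
    rw [Set.finrank, Set.finrank, hspan, Submodule.span_eq] at this
    exact this.symm
  let b := Module.finBasis ℤ M
  let g : s → M := fun v => ⟨v, hsL v.2, subset_span v.2⟩
  let f : s → (Fin (finrank ℤ M) → ZMod 3) := fun v i => ((b.repr (g v) i : ℤ) : ZMod 3)
  have hf : Function.Injective f := by
    intro v w hvw
    have hdvd : ∀ i, ∃ q : ℤ, b.repr (g v) i - b.repr (g w) i = 3 * q := fun i =>
      (ZMod.intCast_eq_intCast_iff_dvd_sub _ _ _).1 (congrFun hvw i).symm
    choose q hq using hdvd
    have hu : g v - g w = (3 : ℤ) • ∑ i, q i • b i := by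
      refine b.ext_elem fun i => ?_
      simp [hq, Finsupp.single_apply]
    have hu' : (v : E) - w = (3 : ℝ) • ((∑ i, q i • b i : M) : E) := by
      have := congrArg (Subtype.val : M → E) hu
      rw [Submodule.coe_sub, Submodule.coe_smul] at this
      rw [show (v : E) - w = ((g v : M) : E) - (g w : M) from rfl, this, ← Int.cast_smul_eq_zsmul ℝ]
      norm_num
    have h0 := h v v.2 w w.2 _ (∑ i, q i • b i : M).2.1 hu'
    rw [h0, smul_zero, sub_eq_zero] at hu'
    exact Subtype.ext hu'
  have hfin : Finite s := Finite.of_injective f hf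
  refine ⟨hfin, ?_⟩
  have := Nat.card_le_card_of_injective f hf
  rw [← hrank]
  simpa [Set.ncard] using this

theorem finite_mem_of_isBounded [FiniteDimensional ℝ E] (L : Submodule ℤ E)
    [DiscreteTopology L] {s : Set E} (hs : Bornology.IsBounded s) : {x | x ∈ L ∧ x ∈ s}.Finite := by
  have hd : DiscreteTopology L.toAddSubgroup := inferInstanceAs (DiscreteTopology L)
  have hc : IsClosed (L : Set E) := AddSubgroup.isClosed_of_discrete (H := L.toAddSubgroup)
  have := Metric.finite_isBounded_inter_isClosed (s := (L : Set E)) DiscreteTopology.isDiscrete hs hc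
  exact this.subset fun x hx => ⟨hx.2, hx.1⟩

theorem exists_ne_zero_forall_inner_eq_zero [FiniteDimensional ℝ E] {s : Set E} (hs : s.Finite)
    (g : E → E) (hcard : s.ncard < finrank ℝ E) : ∃ e : E, e ≠ 0 ∧ ∀ y ∈ s, inner ℝ (g y) e = 0 := by
  have : Fintype s := hs.fintype
  let F : E →ₗ[ℝ] (s → ℝ) := LinearMap.pi fun y => innerₛₗ ℝ (g y)
  have hker : LinearMap.ker F ≠ ⊥ := LinearMap.ker_ne_bot_of_finrank_lt (by
    rw [finrank_fintype_fun_eq_card, ← Nat.card_eq_fintype_card]; exact hcard)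
  obtain ⟨e, he, he0⟩ := Submodule.exists_mem_ne_zero_of_ne_bot hker
  exact ⟨e, he0, fun y hy => congrFun (LinearMap.mem_ker.1 he) ⟨y, hy⟩⟩

theorem exists_mem_ne_zero [FiniteDimensional ℝ E] (L : Submodule ℤ E) [DiscreteTopology L]
    [IsZLattice ℝ L] (hE : 1 ≤ finrank ℝ E) : ∃ v ∈ L, v ≠ 0 := by
  by_contra! h
  have hL : (L : Set E) ⊆ {0} := fun v hv => h v hv
  have := span_mono (R := ℝ) hL
  rw [IsZLattice.span_top, span_zero_singleton, top_le_iff] at this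
  rw [← finrank_top ℝ E, ← this, finrank_bot] at hE
  omega

theorem exists_dualLattice_eq [FiniteDimensional ℝ E] (L : Submodule ℤ E) [DiscreteTopology L]
    [IsZLattice ℝ L] : ∃ b : Basis (Fin (finrank ℝ E)) ℝ E,
      dualLattice L = span ℤ (Set.range b) := by
  classical
  have hB : (innerₗ E : LinearMap.BilinForm ℝ E).Nondegenerate :=
    ⟨fun x hx => inner_self_eq_zero.1 (hx x), fun x hx => inner_self_eq_zero.1 (hx x)⟩
  have h := ZLattice.rank ℝ L
  let b := (Module.finBasisOfFinrankEq ℤ L h)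
  refine ⟨LinearMap.BilinForm.dualBasis _ hB (b.ofZLatticeBasis ℝ L), ?_⟩
  rw [← LinearMap.BilinForm.dualSubmodule_span_of_basis, Basis.ofZLatticeBasis_span]
  rfl

theorem exists_primitive_vector (L : Submodule ℤ E) [DiscreteTopology L] {w : E} (hw : w ∈ L)
    (hw0 : w ≠ 0) : ∃ (v : E) (n : ℕ), 0 < n ∧ w = (n : ℝ) • v ∧
      L ⊓ (span ℝ {w}).restrictScalars ℤ = span ℤ {v} := by
  let H : AddSubgroup ℝ := L.toAddSubgroup.comap (LinearMap.toSpanSingleton ℝ E w).toAddMonoidHom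
  have hH : ∀ t, t ∈ H ↔ t • w ∈ L := fun t => Iff.rfl
  obtain ⟨r, hr, hrL⟩ := exists_pos_forall_norm_lt_imp_eq_zero L
  have hwn : 0 < ‖w‖ := norm_pos_iff.2 hw0
  obtain ⟨b, hb⟩ := AddSubgroup.cyclic_of_isolated_zero (H := H) (a := r / ‖w‖) (by positivity) (by
    rw [Set.disjoint_left]
    intro t ht ht'
    have := hrL _ ((hH t).1 ht) (by
      rw [norm_smul, Real.norm_of_nonneg ht'.1.le]
      exact (lt_div_iff₀ hwn).1 ht'.2)
    rcases smul_eq_zero.1 this with h | h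
    · exact ht'.1.ne' h
    · exact hw0 h)
  obtain ⟨m, hm⟩ := AddSubgroup.mem_closure_singleton.1
    (hb ▸ (hH 1).2 (by rwa [one_smul]) : (1 : ℝ) ∈ AddSubgroup.closure {b})
  rw [zsmul_eq_mul] at hm
  have hbH : b ∈ H := hb ▸ AddSubgroup.subset_closure rfl
  have hm0 : m ≠ 0 := by rintro rfl; simp at hm
  -- The cyclic generator may be a negative multiple of `w`; the sign `ε` corrects this.
  obtain ⟨ε, hε, hεm⟩ : ∃ ε : ℤ, ε * ε = 1 ∧ (m.natAbs : ℤ) = ε * m := by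
    rcases Int.natAbs_eq m with h | h
    · exact ⟨1, by norm_num, by omega⟩
    · exact ⟨-1, by norm_num, by omega⟩
  have hεR : (ε : ℝ) * ε = 1 := by exact_mod_cast hε
  have hεmR : ((m.natAbs : ℕ) : ℝ) = ε * m := by
    rw [← Int.cast_natCast, hεm, Int.cast_mul]
  refine ⟨((ε : ℝ) * b) • w, m.natAbs, Int.natAbs_pos.2 hm0, ?_, le_antisymm ?_ ?_⟩
  · rw [smul_smul, hεmR, show (ε : ℝ) * m * (ε * b) = ε * ε * (m * b) by ring, hεR, hm]
    simp
  · rintro x ⟨hx, hx'⟩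
    obtain ⟨t, rfl⟩ := mem_span_singleton.1 hx'
    obtain ⟨j, rfl⟩ := AddSubgroup.mem_closure_singleton.1 (hb ▸ (hH t).2 hx)
    refine mem_span_singleton.2 ⟨j * ε, ?_⟩
    rw [← Int.cast_smul_eq_zsmul ℝ, smul_smul, zsmul_eq_mul]
    push_cast
    rw [show (j : ℝ) * ε * (ε * b) = j * (ε * ε * b) by ring, hεR, one_mul]
  · rw [span_le, Set.singleton_subset_iff]
    refine ⟨?_, Submodule.smul_mem _ _ (mem_span_singleton_self w)⟩
    rw [mul_smul, Int.cast_smul_eq_zsmul]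
    exact L.smul_mem ε ((hH b).1 hbH)

theorem HasLatticeLength.exists_eq_smul {L : Submodule ℤ E} {a b : E} {l : ℝ}
    (h : HasLatticeLength L a b l) : 0 < l ∧ ∃ v ∈ L, v ≠ 0 ∧ b - a = l • v := by
  obtain ⟨v, ⟨hne, ⟨t, ht, rfl⟩, hgen⟩, rfl⟩ := h
  have hba : b - a ≠ 0 := sub_ne_zero.2 hne.symm
  have hn : 0 < ‖b - a‖ := norm_pos_iff.2 hba
  have hmem : t • (b - a) ∈ L :=
    (hgen ▸ mem_span_singleton_self (t • (b - a)) : t • (b - a) ∈ L ⊓ _).1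
  have hl : ‖b - a‖ / ‖t • (b - a)‖ = t⁻¹ := by
    rw [norm_smul, Real.norm_of_nonneg ht.le]
    field_simp
  rw [hl]
  exact ⟨inv_pos.2 ht, _, hmem, smul_ne_zero ht.ne' hba, (inv_smul_smul₀ ht.ne' _).symm⟩

/-- The factor `n` is the index of `v` over the primitive vector on its ray, since lattice length is
measured by the latter. -/
theorem exists_hasLatticeLength (L : Submodule ℤ E) [DiscreteTopology L] {a b v : E} {l : ℝ}
    (hv : v ∈ L) (hv0 : v ≠ 0) (hl : 0 < l) (hab : b - a = l • v) :
    ∃ n : ℕ, 0 < n ∧ HasLatticeLength L a b (n * l) := by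
  obtain ⟨w, n, hn, rfl, hgen⟩ := exists_primitive_vector L hv hv0
  have hn' : (0 : ℝ) < n := by exact_mod_cast hn
  have hw0 : 0 < ‖w‖ := norm_pos_iff.2 (right_ne_zero_of_smul hv0)
  refine ⟨n, hn, w, ⟨?_, ⟨(n * l)⁻¹, by positivity, ?_⟩, ?_⟩, ?_⟩
  · intro h
    rw [h, sub_self] at hab
    exact smul_ne_zero hl.ne' hv0 hab.symm
  · rw [hab, smul_smul, smul_smul, mul_assoc, mul_comm l, inv_mul_cancel₀ (by positivity), one_smul]
  · rw [hab, span_singleton_smul_eq (IsUnit.mk0 l hl.ne')]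
    exact hgen
  · rw [hab, smul_smul, norm_smul, Real.norm_of_nonneg (by positivity)]
    field_simp

theorem bddAbove_latticeLength (L : Submodule ℤ E) [DiscreteTopology L] {C : Set E}
    (hC : Bornology.IsBounded C) :
    BddAbove {l : ℝ | ∃ a b : E, segment ℝ a b ⊆ C ∧ HasLatticeLength L a b l} := by
  obtain ⟨r, hr, hrL⟩ := exists_pos_forall_norm_lt_imp_eq_zero L
  refine ⟨Metric.diam C / r, ?_⟩
  rintro l ⟨a, b, hab, h⟩
  obtain ⟨hl, v, hv, hv0, hba⟩ := h.exists_eq_smul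
  have h1 : r ≤ ‖v‖ := not_lt.1 fun h => hv0 (hrL v hv h)
  have h2 := Metric.dist_le_diam_of_mem hC (hab (right_mem_segment ℝ a b))
    (hab (left_mem_segment ℝ a b))
  rw [dist_eq_norm, hba, norm_smul, Real.norm_of_nonneg hl.le] at h2
  rw [le_div_iff₀ hr]
  exact (mul_le_mul_of_nonneg_left h1 hl.le).trans h2

theorem mul_le_latticeDiam (L : Submodule ℤ E) [DiscreteTopology L] {C : Set E}
    (hC : Convex ℝ C) (hb : Bornology.IsBounded C) {a b v : E} (ha : a ∈ C) (hbC : b ∈ C) {l : ℝ}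
    (hv : v ∈ L) (hv0 : v ≠ 0) (hl : 0 < l) (hab : b - a = l • v) :
    ∃ n : ℕ, 0 < n ∧ HasLatticeLength L a b (n * l) ∧ n * l ≤ latticeDiam L C := by
  obtain ⟨n, hn, h⟩ := exists_hasLatticeLength L hv hv0 hl hab
  exact ⟨n, hn, h, le_csSup (bddAbove_latticeLength L hb) ⟨a, b, hC.segment_subset ha hbC, h⟩⟩

theorem le_latticeDiam (L : Submodule ℤ E) [DiscreteTopology L] {C : Set E}
    (hC : Convex ℝ C) (hb : Bornology.IsBounded C) {v : E} {l : ℝ}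
    (hv : v ∈ L) (hv0 : v ≠ 0) (hl : 0 < l) (hlv : l • v ∈ C - C) : l ≤ latticeDiam L C := by
  obtain ⟨b, hbC, a, ha, hab⟩ := Set.mem_sub.1 hlv
  obtain ⟨n, hn, -, h⟩ := mul_le_latticeDiam L hC hb ha hbC hv hv0 hl hab
  have hn' : (1 : ℝ) ≤ n := by exact_mod_cast hn
  exact (le_mul_of_one_le_left hl.le hn').trans h

theorem latticeDiam_le (L : Submodule ℤ E) {C : Set E} {r : ℝ} (hr : 0 ≤ r)
    (h : ∀ v ∈ L, v ≠ 0 → ∀ l : ℝ, 0 < l → l • v ∈ C - C → l ≤ r) : latticeDiam L C ≤ r := by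
  refine Real.sSup_le ?_ hr
  rintro l ⟨a, b, hab, hl⟩
  obtain ⟨hl0, v, hv, hv0, hba⟩ := hl.exists_eq_smul
  exact h v hv hv0 l hl0 (hba ▸ Set.sub_mem_sub (hab (right_mem_segment ℝ a b))
    (hab (left_mem_segment ℝ a b)))

theorem mem_diamDirections (L : Submodule ℤ E) [DiscreteTopology L] {C : Set E}
    (hC : Convex ℝ C) (hb : Bornology.IsBounded C) (h0 : 0 < latticeDiam L C) {v : E}
    (hv : v ∈ L) (hv0 : v ≠ 0) (h : latticeDiam L C • v ∈ C - C) : v ∈ diamDirections L C := by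
  obtain ⟨b, hbC, a, ha, hab⟩ := Set.mem_sub.1 h
  obtain ⟨n, hn, hlen, hle⟩ := mul_le_latticeDiam L hC hb ha hbC hv hv0 h0 hab
  have hn1 : (1 : ℝ) ≤ n := by exact_mod_cast hn
  -- A non-primitive `v` would give a segment longer than the diameter.
  have hn2 : (n : ℝ) = 1 := le_antisymm (le_of_mul_le_mul_right (by rwa [one_mul]) h0) hn1
  rw [hn2, one_mul] at hlen
  refine ⟨hv, hv0, a, b, hC.segment_subset ha hbC, ?_, hlen⟩
  rw [hab]
  exact mem_span_singleton.2 ⟨(latticeDiam L C)⁻¹, inv_smul_smul₀ h0.ne' v⟩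

theorem exists_widthAlong_eq {C : Set E} (hC : IsCompact C) (hne : C.Nonempty) (y : E) :
    ∃ p ∈ C, ∃ q ∈ C, widthAlong C y = inner ℝ y (p - q) ∧
      (∀ x ∈ C, inner ℝ y x ≤ inner ℝ y p) ∧ ∀ x ∈ C, inner ℝ y q ≤ inner ℝ y x := by
  have hcont : ContinuousOn (fun x : E => inner ℝ y x) C := by fun_prop
  obtain ⟨p, hp, hpmax⟩ := hC.exists_isMaxOn hne hcont
  obtain ⟨q, hq, hqmin⟩ := hC.exists_isMinOn hne hcont
  refine ⟨p, hp, q, hq, ?_, hpmax, hqmin⟩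
  refine IsGreatest.csSup_eq ⟨⟨p, hp, q, hq, rfl⟩, ?_⟩
  rintro r ⟨a, ha, b, hb, rfl⟩
  rw [inner_sub_right, inner_sub_right]
  exact sub_le_sub (hpmax ha) (hqmin hb)

theorem inner_sub_le_widthAlong {C : Set E} (hC : IsCompact C) (y : E) {a b : E} (ha : a ∈ C)
    (hb : b ∈ C) : inner ℝ y (a - b) ≤ widthAlong C y := by
  obtain ⟨p, -, q, -, h, hp, hq⟩ := exists_widthAlong_eq hC ⟨a, ha⟩ y
  rw [h, inner_sub_right, inner_sub_right]
  exact sub_le_sub (hp a ha) (hq b hb)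

theorem widthAlong_le {C : Set E} (hC : IsCompact C) (hne : C.Nonempty) (y : E) {r : ℝ}
    (h : ∀ a ∈ C, ∀ b ∈ C, inner ℝ y (a - b) ≤ r) : widthAlong C y ≤ r := by
  obtain ⟨p, hp, q, hq, hpq, -⟩ := exists_widthAlong_eq hC hne y
  exact hpq ▸ h p hp q hq

theorem widthAlong_nonneg {C : Set E} (hC : IsCompact C) (hne : C.Nonempty) (y : E) :
    0 ≤ widthAlong C y := by
  obtain ⟨p, hp⟩ := hne
  simpa using inner_sub_le_widthAlong hC y hp hp

theorem latticeWidth_le (L : Submodule ℤ E) {C : Set E} (hC : IsCompact C) (hne : C.Nonempty)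
    {y : E} (hy : y ∈ dualLattice L) (hy0 : y ≠ 0) : latticeWidth L C ≤ widthAlong C y :=
  csInf_le ⟨0, by rintro _ ⟨z, -, -, rfl⟩; exact widthAlong_nonneg hC hne z⟩ ⟨y, hy, hy0, rfl⟩

theorem exists_mul_norm_le_widthAlong {C : Set E} (hC : IsConvexBody C) :
    ∃ r > 0, ∀ y, r * ‖y‖ ≤ widthAlong C y := by
  obtain ⟨x, hx⟩ := hC.interior_nonempty
  obtain ⟨r, hr, hball⟩ := Metric.nhds_basis_closedBall.mem_iff.1 (mem_interior_iff_mem_nhds.1 hx)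
  refine ⟨r, hr, fun y => ?_⟩
  rcases eq_or_ne y 0 with rfl | hy
  · simpa using widthAlong_nonneg hC.isCompact ⟨x, interior_subset hx⟩ 0
  · have hn : ‖y‖ ≠ 0 := norm_ne_zero_iff.2 hy
    have hmem : x + (r / ‖y‖) • y ∈ C := hball (by
      rw [mem_closedBall_iff_norm, add_sub_cancel_left, norm_smul, Real.norm_of_nonneg (by positivity),
        div_mul_cancel₀ _ hn])
    have := inner_sub_le_widthAlong hC.isCompact y hmem (interior_subset hx)
    rw [add_sub_cancel_left, inner_smul_right, real_inner_self_eq_norm_sq] at this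
    refine le_trans (le_of_eq ?_) this
    field_simp

theorem neg_mem_widthDirections (L : Submodule ℤ E) {C : Set E} {y : E}
    (hy : y ∈ widthDirections L C) : -y ∈ widthDirections L C := by
  refine ⟨neg_mem hy.1, neg_ne_zero.2 hy.2.1, ?_⟩
  rw [← hy.2.2, widthAlong, widthAlong]
  congr 1
  ext r
  constructor <;> rintro ⟨a, ha, b, hb, rfl⟩ <;> refine ⟨b, hb, a, ha, ?_⟩ <;>
    simp only [inner_sub_right, inner_neg_left] <;> ring

theorem latticeDiam_nonneg (L : Submodule ℤ E) (C : Set E) : 0 ≤ latticeDiam L C :=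
  Real.sSup_nonneg fun _ ⟨_, _, _, h⟩ => h.exists_eq_smul.1.le

end Basic

/-! ### Lower bounds by perturbing the body. -/

section LowerBounds

variable {E : Type*} [NormedAddCommGroup E] [InnerProductSpace ℝ E] [FiniteDimensional ℝ E]

theorem discreteTopology_dualLattice (L : Submodule ℤ E) [DiscreteTopology L] [IsZLattice ℝ L] :
    DiscreteTopology (dualLattice L) := by
  obtain ⟨b, hb⟩ := exists_dualLattice_eq L
  rw [hb]
  infer_instance

theorem span_dualLattice (L : Submodule ℤ E) [DiscreteTopology L] [IsZLattice ℝ L] :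
    span ℝ (dualLattice L : Set E) = ⊤ := by
  obtain ⟨b, hb⟩ := exists_dualLattice_eq L
  rw [hb]
  exact IsZLattice.span_top

theorem eventually_le_one_sub_mul {a b : ℝ} (h : a < b) : ∀ᶠ ε in 𝓝[>] (0 : ℝ), a ≤ (1 - ε) * b := by
  have ht : Tendsto (fun ε : ℝ => (1 - ε) * b) (𝓝 0) (𝓝 ((1 - 0) * b)) :=
    Continuous.tendsto (by fun_prop) 0
  rw [sub_zero, one_mul] at ht
  exact nhdsWithin_le_nhds ((ht.eventually_const_lt h).mono fun _ h => h.le)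

theorem widthDirections_nonempty (L : Submodule ℤ E) [DiscreteTopology L] [IsZLattice ℝ L]
    (hE : 1 ≤ finrank ℝ E) {C : Set E} (hC : IsConvexBody C) : (widthDirections L C).Nonempty := by
  have := discreteTopology_dualLattice L
  have : IsZLattice ℝ (dualLattice L) := ⟨span_dualLattice L⟩
  obtain ⟨r, hr, hrC⟩ := exists_mul_norm_le_widthAlong hC
  obtain ⟨z, hz, hz0⟩ := exists_mem_ne_zero (dualLattice L) hE
  have hfin := finite_mem_of_isBounded (dualLattice L)
    (Metric.isBounded_closedBall (x := (0 : E)) (r := widthAlong C z / r))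
  have hmem : ∀ y, y ∈ dualLattice L → widthAlong C y ≤ widthAlong C z →
      y ∈ {y | y ∈ dualLattice L ∧ y ∈ Metric.closedBall (0 : E) (widthAlong C z / r)} := by
    intro y hy hyz
    refine ⟨hy, ?_⟩
    rw [mem_closedBall_zero_iff, le_div_iff₀ hr, mul_comm]
    exact (hrC y).trans hyz
  obtain ⟨y, ⟨⟨hy, -⟩, hy0⟩, hmin⟩ := Set.exists_min_image _ (widthAlong C)
    (hfin.sdiff (t := {0})) ⟨z, hmem z hz le_rfl, hz0⟩
  refine ⟨y, hy, hy0, le_antisymm ?_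
    (latticeWidth_le L hC.isCompact (hC.interior_nonempty.mono interior_subset) hy hy0)⟩
  refine le_csInf ⟨_, y, hy, hy0, rfl⟩ ?_
  rintro _ ⟨x, hx, hx0, rfl⟩
  by_cases hxz : widthAlong C x ≤ widthAlong C z
  · exact hmin x ⟨hmem x hx hxz, hx0⟩
  · exact (hmin z ⟨hmem z hz le_rfl, hz0⟩).trans (not_le.1 hxz).le

/-- If there were fewer than `finrank ℝ E` minimal directions, `(1 - ε) C + ε P`, with `P` the hull
of their support points, would be a smaller body of the same width. -/
theorem IsLatticeReduced.finrank_le_three_pow (L : Submodule ℤ E) [DiscreteTopology L]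
    [IsZLattice ℝ L] (hE : 1 ≤ finrank ℝ E) {C : Set E} (hC : IsLatticeReduced L C) :
    finrank ℝ E ≤ 3 ^ finrank ℝ (span ℝ (widthDirections L C)) := by
  obtain ⟨hB, hmin⟩ := hC
  have := discreteTopology_dualLattice L
  have hcomp := hB.isCompact
  have hne : C.Nonempty := hB.interior_nonempty.mono interior_subset
  obtain ⟨r, hr, hrC⟩ := exists_mul_norm_le_widthAlong hB
  obtain ⟨hDfin, hDcard⟩ := finite_and_ncard_le_three_pow (dualLattice L)
    (s := widthDirections L C) (fun y hy => hy.1) (by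
      intro v hv w hw u hu hvw
      by_contra hu0
      have h1 := latticeWidth_le L hcomp hne hu hu0
      -- Since `u = (v - w) / 3`, each of `v` and `w` contributes a third of the width. Modulo 2 the
      -- bound would be the width itself, with no contradiction.
      have h2 : widthAlong C u ≤ 2 / 3 * latticeWidth L C := by
        refine widthAlong_le hcomp hne u fun a ha b hb => ?_
        have h3 := inner_sub_le_widthAlong hcomp v ha hb
        have h4 := inner_sub_le_widthAlong hcomp w hb ha
        rw [hv.2.2] at h3
        rw [hw.2.2, ← neg_sub, inner_neg_right] at h4
        have h5 : inner ℝ (v - w) (a - b) = 3 * inner ℝ u (a - b) := by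
          rw [hvw, real_inner_smul_left]
        rw [inner_sub_left] at h5
        linarith
      have h6 := hrC v
      have h7 : 0 < r * ‖v‖ := mul_pos hr (norm_pos_iff.2 hv.2.1)
      rw [hv.2.2] at h6
      linarith)
  refine le_trans ?_ hDcard
  by_contra! hlt
  choose p hp q hq hpq hpmax hqmin using exists_widthAlong_eq hcomp hne
  obtain ⟨e, he0, he⟩ := exists_ne_zero_forall_inner_eq_zero hDfin p hlt
  obtain ⟨y₀, hy₀⟩ := widthDirections_nonempty L hE hB
  -- Uniform gap: only finitely many `y` have width at most the minimum plus one, and the others are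
  -- handled by that extra one.
  obtain ⟨ε, hε, hε1, hεw⟩ : ∃ ε : ℝ, 0 < ε ∧ ε < 1 ∧ ∀ y ∈ dualLattice L, y ≠ 0 →
      y ∉ widthDirections L C → latticeWidth L C ≤ (1 - ε) * widthAlong C y := by
    have hfin := finite_mem_of_isBounded (dualLattice L)
      (Metric.isBounded_closedBall (x := (0 : E)) (r := (latticeWidth L C + 1) / r))
    have h1 : ∀ᶠ ε in 𝓝[>] (0 : ℝ), ∀ y ∈ {y | y ∈ dualLattice L ∧
        y ∈ Metric.closedBall (0 : E) ((latticeWidth L C + 1) / r)}, y ≠ 0 →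
        y ∉ widthDirections L C → latticeWidth L C ≤ (1 - ε) * widthAlong C y := by
      refine (eventually_all_finite hfin).2 fun y hy => ?_
      by_cases h : y ≠ 0 ∧ y ∉ widthDirections L C
      · have hlt : latticeWidth L C < widthAlong C y :=
          lt_of_le_of_ne (latticeWidth_le L hcomp hne hy.1 h.1) fun h' => h.2 ⟨hy.1, h.1, h'.symm⟩
        exact (eventually_le_one_sub_mul hlt).mono fun ε hε _ _ => hε
      · exact Eventually.of_forall fun ε h1 h2 => absurd ⟨h1, h2⟩ h
    have h2 : ∀ᶠ ε in 𝓝[>] (0 : ℝ), latticeWidth L C ≤ (1 - ε) * (latticeWidth L C + 1) :=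
      eventually_le_one_sub_mul (lt_add_one _)
    have h3 : ∀ᶠ ε in 𝓝[>] (0 : ℝ), ε < 1 := nhdsWithin_le_nhds (eventually_lt_nhds one_pos)
    obtain ⟨ε, ⟨⟨h1, h2⟩, h3⟩, h4⟩ := (((h1.and h2).and h3).and self_mem_nhdsWithin).exists
    refine ⟨ε, h4, h3, fun y hy hy0 hyD => ?_⟩
    by_cases hyw : widthAlong C y ≤ latticeWidth L C + 1
    · refine h1 y ⟨hy, ?_⟩ hy0 hyD
      rw [mem_closedBall_zero_iff, le_div_iff₀ hr, mul_comm]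
      exact (hrC y).trans hyw
    · exact h2.trans (mul_le_mul_of_nonneg_left (not_le.1 hyw).le (by linarith))
  set P := convexHull ℝ (p '' widthDirections L C) with hP
  have hpP : ∀ y ∈ widthDirections L C, p y ∈ P := fun y hy =>
    subset_convexHull ℝ _ (mem_image_of_mem p hy)
  have hPC : P ⊆ C := convexHull_min (image_subset_iff.2 fun y _ => hp y) hB.convex
  have hPe : ∀ x ∈ P, inner ℝ e x = 0 := by
    have : P ⊆ LinearMap.ker (innerₛₗ ℝ e) := convexHull_min
      (image_subset_iff.2 fun y hy => by
        rw [mem_preimage, SetLike.mem_coe, LinearMap.mem_ker, innerₛₗ_apply_apply, real_inner_comm]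
        exact he y hy)
      (Submodule.convex _)
    exact fun x hx => this hx
  have hmem : ∀ x ∈ C, ∀ z ∈ P, (1 - ε) • x + ε • z ∈ (1 - ε) • C + ε • P := fun x hx z hz =>
    add_mem_add (smul_mem_smul_set hx) (smul_mem_smul_set hz)
  have hsub : (1 - ε) • C + ε • P ⊆ C := by
    rintro _ ⟨_, ⟨x, hx, rfl⟩, _, ⟨z, hz, rfl⟩, rfl⟩
    exact hB.convex hx (hPC hz) (by linarith) hε.le (by ring)
  have hbody : IsConvexBody ((1 - ε) • C + ε • P) := by
    refine ⟨(hB.convex.smul _).add ((convex_convexHull ℝ _).smul _),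
      (hcomp.smul _).add (((hDfin.image p).isCompact_convexHull ℝ).smul _), ?_⟩
    have hopen : IsOpen ((1 - ε) • interior C + ε • P) :=
      (isOpen_interior.smul₀ (by linarith : 1 - ε ≠ 0)).add_right
    refine Nonempty.mono (interior_maximal (add_subset_add
      (smul_set_mono interior_subset) Subset.rfl) hopen) ?_
    exact hB.interior_nonempty.smul_set.add (Nonempty.smul_set ⟨_, hpP y₀ hy₀⟩)
  have hne' := hbody.interior_nonempty.mono interior_subset
  refine hmin ⟨_, hbody, ⟨hsub, fun hsup => ?_⟩, le_antisymm ?_ ?_⟩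
  -- `P` lies in the hyperplane orthogonal to `e`, so equality of the bodies would give `max e ≤ (1
  -- - ε) max e`, and similarly for the minimum. The width along `e` would then be nonpositive.
  · have hpe : inner ℝ e (p e) ≤ 0 := by
      obtain ⟨_, ⟨x, hx, rfl⟩, _, ⟨z, hz, rfl⟩, h⟩ := hsup (hp e)
      have h1 := congrArg (inner ℝ e) h
      simp only [inner_add_right, inner_smul_right, hPe z hz] at h1
      nlinarith [hpmax e x hx]
    have hqe : 0 ≤ inner ℝ e (q e) := by
      obtain ⟨_, ⟨x, hx, rfl⟩, _, ⟨z, hz, rfl⟩, h⟩ := hsup (hq e)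
      have h1 := congrArg (inner ℝ e) h
      simp only [inner_add_right, inner_smul_right, hPe z hz] at h1
      nlinarith [hqmin e x hx]
    have h1 := hrC e
    have h2 : 0 < r * ‖e‖ := mul_pos hr (norm_pos_iff.2 he0)
    rw [hpq, inner_sub_right] at h1
    linarith
  · refine (latticeWidth_le L hbody.isCompact hne' hy₀.1 hy₀.2.1).trans ?_
    rw [← hy₀.2.2]
    exact widthAlong_le hbody.isCompact hne' y₀ fun a ha b hb =>
      inner_sub_le_widthAlong hcomp y₀ (hsub ha) (hsub hb)
  · refine le_csInf ⟨_, y₀, hy₀.1, hy₀.2.1, rfl⟩ ?_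
    rintro _ ⟨y, hy, hy0, rfl⟩
    by_cases hyD : y ∈ widthDirections L C
    · have hpmem : ∀ z ∈ widthDirections L C, p z ∈ (1 - ε) • C + ε • P := fun z hz => by
        have := hmem (p z) (hp z) (p z) (hpP z hz)
        rwa [← add_smul, sub_add_cancel, one_smul] at this
      -- The chosen maximizer for `-y` is a minimizer for `y`, and both points survive in the
      -- smaller body.
      refine le_trans ?_ (inner_sub_le_widthAlong hbody.isCompact y (hpmem y hyD)
        (hpmem (-y) (neg_mem_widthDirections L hyD)))
      rw [← hyD.2.2, hpq, inner_sub_right, inner_sub_right]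
      have := hpmax (-y) (q y) (hq y)
      simp only [inner_neg_left] at this
      linarith
    · refine (hεw y hy hy0 hyD).trans ?_
      have h := inner_sub_le_widthAlong hbody.isCompact y (hmem (p y) (hp y) _ (hpP y₀ hy₀))
        (hmem (q y) (hq y) _ (hpP y₀ hy₀))
      rwa [add_sub_add_right_eq_sub, ← smul_sub, inner_smul_right, ← hpq] at h

/-- If there were fewer than `finrank ℝ E` diameter directions, `C` plus a short segment along `e`,
with `e` tangent to supporting hyperplanes of `C - C` at all points `δ • v`, would be a larger body
of the same diameter. -/
theorem IsLatticeComplete.finrank_le_three_pow (L : Submodule ℤ E) [DiscreteTopology L]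
    [IsZLattice ℝ L] (hE : 1 ≤ finrank ℝ E) {C : Set E} (hC : IsLatticeComplete L C) :
    finrank ℝ E ≤ 3 ^ finrank ℝ (span ℝ (diamDirections L C)) := by
  obtain ⟨hB, hmax⟩ := hC
  have hcomp := hB.isCompact
  have hbdd := hcomp.isBounded
  have hne : C.Nonempty := hB.interior_nonempty.mono interior_subset
  have hKconv : Convex ℝ (C - C) := hB.convex.sub hB.convex
  have hKcomp : IsCompact (C - C) := sub_eq_add_neg C C ▸ hcomp.add hcomp.neg
  have hKneg : ∀ x ∈ C - C, -x ∈ C - C := by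
    rintro _ ⟨a, ha, b, hb, rfl⟩
    rw [neg_sub]
    exact sub_mem_sub hb ha
  have h0int : (0 : E) ∈ interior (C - C) := by
    obtain ⟨x, hx⟩ := hB.interior_nonempty
    refine interior_maximal (sub_subset_sub interior_subset Subset.rfl) isOpen_interior.sub_right ?_
    exact ⟨x, hx, x, interior_subset hx, sub_self x⟩
  have h0 : (0 : E) ∈ C - C := interior_subset h0int
  have hle : ∀ v ∈ L, v ≠ 0 → ∀ l : ℝ, 0 < l → l • v ∈ C - C → l ≤ latticeDiam L C :=
    fun v hv hv0 l hl h => le_latticeDiam L hB.convex hbdd hv hv0 hl h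
  have hgrow : ∀ (v : E) (l : ℝ), l • v ∈ interior (C - C) → ∃ s > l, s • v ∈ C - C := by
    intro v l hl
    have hc : ContinuousAt (fun s : ℝ => s • v) l := by fun_prop
    have h1 : ∀ᶠ s in 𝓝[>] l, s • v ∈ C - C :=
      nhdsWithin_le_nhds (hc.eventually (mem_interior_iff_mem_nhds.1 hl))
    obtain ⟨s, h2, h3⟩ := (h1.and self_mem_nhdsWithin).exists
    exact ⟨s, h3, h2⟩
  set δ := latticeDiam L C with hδ
  have hδ0 : 0 < δ := by
    obtain ⟨v, hv, hv0⟩ := exists_mem_ne_zero L hE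
    obtain ⟨s, hs, hsv⟩ := hgrow v 0 (by rwa [zero_smul])
    exact lt_of_lt_of_le hs (hle v hv hv0 s hs hsv)
  let V : Set E := {v | v ∈ L ∧ v ≠ 0 ∧ δ • v ∈ C - C}
  obtain ⟨hVfin, hVcard⟩ := finite_and_ncard_le_three_pow L (s := V) (fun v hv => hv.1) (by
    intro v hv w hw u hu hvw
    by_contra hu0
    -- The midpoint of `δ v` and `-δ w` is `(3δ/2) u`, which is too long.
    have h1 := hKconv hv.2.2 (hKneg _ hw.2.2) (by norm_num : (0 : ℝ) ≤ 1 / 2)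
      (by norm_num : (0 : ℝ) ≤ 1 / 2) (by norm_num)
    rw [← smul_add, ← sub_eq_add_neg, ← smul_sub, hvw, smul_smul, smul_smul] at h1
    have := hle u hu hu0 _ (by positivity) h1
    linarith)
  have hVD : V ⊆ diamDirections L C := fun v hv =>
    mem_diamDirections L hB.convex hbdd hδ0 hv.1 hv.2.1 hv.2.2
  refine le_trans ?_ (hVcard.trans (Nat.pow_le_pow_right (by norm_num)
    (Submodule.finrank_mono (span_mono hVD))))
  by_contra! hlt
  have hsupp : ∀ v, ∃ g : E, v ∈ V → 0 < inner ℝ g v ∧ ∀ x ∈ C - C, inner ℝ g x ≤ δ * inner ℝ g v := by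
    intro v
    by_cases hv : v ∈ V
    swap
    · exact ⟨0, fun h => absurd h hv⟩
    obtain ⟨f, hf⟩ := geometric_hahn_banach_open_point hKconv.interior isOpen_interior
      (x := δ • v) fun h => by
        obtain ⟨s, hs, hsv⟩ := hgrow v δ h
        exact absurd (hle v hv.1 hv.2.1 s (hδ0.trans hs) hsv) (not_le.2 hs)
    have : CompleteSpace E := FiniteDimensional.complete ℝ E
    refine ⟨(InnerProductSpace.toDual ℝ E).symm f, fun _ => ?_⟩
    simp only [InnerProductSpace.toDual_symm_apply]
    rw [map_smul, smul_eq_mul] at hf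
    refine ⟨?_, fun x hx => ?_⟩
    · have := hf 0 h0int
      rw [map_zero] at this
      exact pos_of_mul_pos_right this hδ0.le
    · have hx' : x ∈ closure (interior (C - C)) := by
        rw [hKconv.closure_interior_eq_closure_of_nonempty_interior ⟨0, h0int⟩]
        exact subset_closure hx
      exact closure_minimal (t := {x | f x ≤ δ * f v}) (fun z hz => (hf z hz).le)
        (isClosed_le f.continuous continuous_const) hx'
  choose g hg using hsupp
  obtain ⟨e, he0, he⟩ := exists_ne_zero_forall_inner_eq_zero hVfin g hlt
  obtain ⟨ε, hε, hεV⟩ : ∃ ε : ℝ, 0 < ε ∧ ∀ v ∈ L, v ≠ 0 → v ∉ V → ∀ s : ℝ, |s| ≤ ε →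
      δ • v - s • e ∉ C - C := by
    obtain ⟨R, hR⟩ := hKcomp.isBounded.exists_norm_le
    have hfin := finite_mem_of_isBounded L
      (Metric.isBounded_closedBall (x := (0 : E)) (r := (R + ‖e‖) / δ))
    have h1 : ∀ᶠ s in 𝓝 (0 : ℝ), ∀ v ∈ {v | v ∈ L ∧
        v ∈ Metric.closedBall (0 : E) ((R + ‖e‖) / δ)}, v ≠ 0 → v ∉ V → δ • v - s • e ∉ C - C := by
      refine (eventually_all_finite hfin).2 fun v hv => ?_
      by_cases h : v ≠ 0 ∧ v ∉ V
      · have hc : ContinuousAt (fun s : ℝ => δ • v - s • e) 0 := by fun_prop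
        have hnot : δ • v - (0 : ℝ) • e ∈ (C - C)ᶜ := by
          rw [zero_smul, sub_zero]
          exact fun h' => h.2 ⟨hv.1, h.1, h'⟩
        exact (hc.eventually (hKcomp.isClosed.isOpen_compl.mem_nhds hnot)).mono fun s hs _ _ => hs
      · exact Eventually.of_forall fun s h1 h2 => absurd ⟨h1, h2⟩ h
    obtain ⟨η, hη, hηV⟩ := Metric.eventually_nhds_iff.1 h1
    -- The cap at 1 bounds `‖s • e‖` by `‖e‖`, which is what the radius `(R + ‖e‖) / δ` allows for.
    refine ⟨min (η / 2) 1, by positivity, fun v hv hv0 hvV s hs hmem => ?_⟩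
    have hs1 : |s| ≤ 1 := hs.trans (min_le_right _ _)
    refine hηV (y := s) ?_ v ⟨hv, ?_⟩ hv0 hvV hmem
    · rw [Real.dist_eq, sub_zero]
      linarith [hs.trans (min_le_left _ _)]
    · rw [mem_closedBall_zero_iff, le_div_iff₀ hδ0]
      have h2 : ‖δ • v‖ ≤ ‖δ • v - s • e‖ + ‖s • e‖ := by
        simpa using norm_add_le (δ • v - s • e) (s • e)
      rw [norm_smul, norm_smul, Real.norm_of_nonneg hδ0.le, Real.norm_eq_abs] at h2
      nlinarith [hR _ hmem, norm_nonneg e]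
  set S : Set E := LinearMap.toSpanSingleton ℝ E e '' Icc 0 ε with hS
  have hScomp : IsCompact S := isCompact_Icc.image (LinearMap.continuous_of_finiteDimensional _)
  have hSconv : Convex ℝ S := (convex_Icc 0 ε).linear_image _
  have hsub : C ⊆ C + S := fun x hx => ⟨x, hx, 0, ⟨0, ⟨le_rfl, hε.le⟩, by simp⟩, add_zero x⟩
  have hbody : IsConvexBody (C + S) := ⟨hB.convex.add hSconv, hcomp.add hScomp,
    hB.interior_nonempty.mono (interior_mono hsub)⟩
  refine hmax ⟨C + S, hbody, ⟨hsub, fun hsup => ?_⟩, le_antisymm ?_ ?_⟩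
  · obtain ⟨p, hp, -, -, -, hpmax, -⟩ := exists_widthAlong_eq hcomp hne e
    have h1 := hpmax _ (hsup (add_mem_add hp ⟨ε, ⟨hε.le, le_rfl⟩, rfl⟩))
    rw [LinearMap.toSpanSingleton_apply, inner_add_right, inner_smul_right] at h1
    have h2 : 0 < inner ℝ e e := real_inner_self_pos.2 he0
    nlinarith
  · refine latticeDiam_le L hδ0.le fun v hv hv0 l hl hlv => ?_
    obtain ⟨k, hk, s, hs, hks⟩ : ∃ k ∈ C - C, ∃ s : ℝ, |s| ≤ ε ∧ l • v = k + s • e := by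
      obtain ⟨_, ⟨a, ha, _, ⟨s, hs, rfl⟩, rfl⟩, _, ⟨b, hb, _, ⟨t, ht, rfl⟩, rfl⟩, h⟩ := hlv
      refine ⟨a - b, sub_mem_sub ha hb, s - t, abs_le.2 ⟨?_, ?_⟩, ?_⟩
      · linarith [hs.1, ht.2]
      · linarith [hs.2, ht.1]
      · rw [← h]
        simp only [LinearMap.toSpanSingleton_apply, sub_smul]
        abel
    by_cases hvV : v ∈ V
    · obtain ⟨h1, h2⟩ := hg v hvV
      have h3 := congrArg (inner ℝ (g v)) hks
      rw [inner_add_right, inner_smul_right, inner_smul_right, he v hvV, mul_zero, add_zero] at h3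
      exact le_of_mul_le_mul_right (h3.le.trans (h2 k hk)) h1
    -- Shrinking the too-long vector to length `δ` shrinks its `e`-component as well, so the gap
    -- still applies.
    · by_contra! hδl
      have hq1 : δ / l ≤ 1 := (div_le_one hl).2 hδl.le
      have hq0 : 0 ≤ δ / l := by positivity
      refine hεV v hv hv0 hvV (δ / l * s) ?_ ?_
      · rw [abs_mul, abs_of_nonneg hq0]
        exact (mul_le_of_le_one_left (abs_nonneg s) hq1).trans hs
      · have h1 : δ • v = (δ / l) • (k + s • e) := by
          rw [← hks, smul_smul, div_mul_cancel₀ _ hl.ne']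
        rw [h1, smul_add, smul_smul, add_sub_cancel_right]
        exact hKconv.smul_mem_of_zero_mem h0 hk ⟨hq0, hq1⟩
  · refine latticeDiam_le L (latticeDiam_nonneg L _) fun v hv hv0 l hl hlv => ?_
    exact le_latticeDiam L hbody.convex hbody.isCompact.isBounded hv hv0 hl
      (sub_subset_sub hsub hsub hlv)

end LowerBounds

/-! ### Reduced and complete polytopes from a facet system. -/

section Frames

variable {E : Type*} [NormedAddCommGroup E] [InnerProductSpace ℝ E]

/-- Functionals `⟪p j, ·⟫` defining a norm `max |⟪p j, ·⟫|` which is at least one on the non-zero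
vectors of `L`, together with vectors `y j ∈ L` lying in the relative interior of the facets of
the unit ball of this norm. -/
structure IsFacetSystem (L : Submodule ℤ E) {J : Type*} (p y : J → E) : Prop where
  mem (j : J) : y j ∈ L
  inner_self (j : J) : inner ℝ (p j) (y j) = (1 : ℝ)
  abs_inner_lt (i j : J) : i ≠ j → |inner ℝ (p i) (y j)| < (1 : ℝ)
  exists_one_le (z : E) : z ∈ L → z ≠ 0 → ∃ j, (1 : ℝ) ≤ |inner ℝ (p j) z|
  eq_zero (x : E) : (∀ j, inner ℝ (p j) x = (0 : ℝ)) → x = 0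

theorem IsFacetSystem.ne_zero {L : Submodule ℤ E} {J : Type*} {p y : J → E}
    (h : IsFacetSystem L p y) (j : J) : y j ≠ 0 := by
  intro h0
  have := h.inner_self j
  simp [h0] at this

/-- This turns a strict inequality at all generators but one into uniqueness of the maximizer on
their convex hull. -/
theorem convex_insert_setOf_lt (f : E →ₗ[ℝ] ℝ) {c : ℝ} {p : E} (hp : f p ≤ c) :
    Convex ℝ (insert p {x | f x < c}) := by
  rw [convex_iff_forall_pos]
  rintro x hx z hz a b ha hb hab
  simp only [mem_insert_iff, mem_ofPred_eq] at hx hz ⊢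
  rw [map_add, map_smul, map_smul, smul_eq_mul, smul_eq_mul]
  have hc : c = a * c + b * c := by rw [← add_mul, hab, one_mul]
  rcases hx with rfl | hx <;> rcases hz with rfl | hz
  · left; rw [← add_smul, hab, one_smul]
  all_goals right; rw [hc]
  · exact add_lt_add_of_le_of_lt (mul_le_mul_of_nonneg_left hp ha.le) (mul_lt_mul_of_pos_left hz hb)
  · exact add_lt_add_of_lt_of_le (mul_lt_mul_of_pos_left hx ha) (mul_le_mul_of_nonneg_left hp hb.le)
  · exact add_lt_add (mul_lt_mul_of_pos_left hx ha) (mul_lt_mul_of_pos_left hz hb)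

/-- The convex hull of the points `± p j`. -/
def symmHull {J : Type*} (p : J → E) : Set E := convexHull ℝ (range p ∪ -range p)

theorem mem_symmHull {J : Type*} (p : J → E) (j : J) : p j ∈ symmHull p :=
  subset_convexHull ℝ _ (Or.inl ⟨j, rfl⟩)

theorem neg_mem_symmHull {J : Type*} (p : J → E) (j : J) : -p j ∈ symmHull p :=
  subset_convexHull ℝ _ (Or.inr (by simp))

theorem neg_mem_symmHull_of_mem {J : Type*} {p : J → E} {x : E} (hx : x ∈ symmHull p) :
    -x ∈ symmHull p := by
  have : symmHull p = -symmHull p := by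
    rw [symmHull, ← convexHull_neg, union_neg, neg_neg, union_comm]
  rw [this]
  simpa using hx

theorem isCompact_symmHull {J : Type*} [Finite J] (p : J → E) : IsCompact (symmHull p) :=
  ((finite_range p).union (finite_range p).neg).isCompact_convexHull ℝ

theorem IsFacetSystem.mem_insert_of_mem_symmHull {L : Submodule ℤ E} {J : Type*} {p y : J → E}
    (h : IsFacetSystem L p y) (j : J) {x : E} (hx : x ∈ symmHull p) :
    x = p j ∨ inner ℝ (y j) x < (1 : ℝ) := by
  refine convexHull_min ?_ (convex_insert_setOf_lt (innerₛₗ ℝ (y j)) (c := 1) (p := p j) ?_) hx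
  · rintro z (⟨i, rfl⟩ | hz)
    · rcases eq_or_ne i j with rfl | hij
      · exact Or.inl rfl
      · right
        rw [mem_ofPred_eq, innerₛₗ_apply_apply, real_inner_comm]
        exact (abs_lt.1 (h.abs_inner_lt i j hij)).2
    · obtain ⟨i, hi⟩ := hz
      right
      rw [← neg_neg z, ← hi, mem_ofPred_eq, innerₛₗ_apply_apply, real_inner_comm, inner_neg_left]
      rcases eq_or_ne i j with rfl | hij
      · rw [h.inner_self]; norm_num
      · linarith [(abs_lt.1 (h.abs_inner_lt i j hij)).1]
  · rw [innerₛₗ_apply_apply, real_inner_comm, h.inner_self]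

theorem IsFacetSystem.isConvexBody_symmHull [FiniteDimensional ℝ E] {L : Submodule ℤ E}
    {J : Type*} [Finite J] [Nonempty J] {p y : J → E} (h : IsFacetSystem L p y) :
    IsConvexBody (symmHull p) := by
  refine ⟨convex_convexHull ℝ _, isCompact_symmHull p, ?_⟩
  obtain ⟨j₀⟩ := ‹Nonempty J›
  rw [symmHull, interior_convexHull_nonempty_iff_affineSpan_eq_top,
    AffineSubspace.affineSpan_eq_top_iff_vectorSpan_eq_top_of_nonempty ℝ E E ⟨p j₀, Or.inl ⟨j₀, rfl⟩⟩]
  set U := vectorSpan ℝ (range p ∪ -range p)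
  have hU : ∀ j, p j ∈ U := by
    intro j
    have := vsub_mem_vectorSpan ℝ (s := range p ∪ -range p) (Or.inl ⟨j, rfl⟩ : p j ∈ _)
      (Or.inr (by simp) : -p j ∈ _)
    rw [vsub_eq_sub, sub_neg_eq_add, ← two_smul ℝ] at this
    simpa using U.smul_mem (2⁻¹ : ℝ) this
  rw [← Submodule.orthogonal_eq_bot_iff, Submodule.eq_bot_iff]
  exact fun x hx => h.eq_zero x fun j => (Submodule.mem_orthogonal U x).1 hx _ (hU j)

theorem two_mul_abs_inner_le_widthAlong_symmHull {J : Type*} [Finite J] (p : J → E) (j : J)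
    (z : E) : 2 * |inner ℝ (p j) z| ≤ widthAlong (symmHull p) z := by
  have h1 := inner_sub_le_widthAlong (isCompact_symmHull p) z (mem_symmHull p j)
    (neg_mem_symmHull p j)
  have h2 := inner_sub_le_widthAlong (isCompact_symmHull p) z (neg_mem_symmHull p j)
    (mem_symmHull p j)
  rw [inner_sub_right, inner_neg_right, real_inner_comm] at h1 h2
  rcases abs_cases (inner ℝ (p j) z : ℝ) with h | h <;> linarith

theorem IsFacetSystem.latticeWidth_symmHull {L : Submodule ℤ E}
    {J : Type*} [Finite J] [Nonempty J] {p y : J → E} (h : IsFacetSystem (dualLattice L) p y) :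
    latticeWidth L (symmHull p) = 2 := by
  obtain ⟨j₀⟩ := ‹Nonempty J›
  have hne : (symmHull p).Nonempty := ⟨_, mem_symmHull p j₀⟩
  have hle : ∀ x ∈ symmHull p, inner ℝ (y j₀) x ≤ (1 : ℝ) := by
    intro x hx
    rcases h.mem_insert_of_mem_symmHull j₀ hx with rfl | hx
    · rw [real_inner_comm, h.inner_self]
    · exact hx.le
  refine le_antisymm ?_ ?_
  · refine (latticeWidth_le L (isCompact_symmHull p) hne (h.mem j₀) (h.ne_zero j₀)).trans ?_
    refine widthAlong_le (isCompact_symmHull p) hne _ fun a ha b hb => ?_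
    have h1 := hle a ha
    have h2 := hle _ (neg_mem_symmHull_of_mem hb)
    rw [inner_neg_right] at h2
    rw [inner_sub_right]
    linarith
  · refine le_csInf ⟨_, y j₀, h.mem j₀, h.ne_zero j₀, rfl⟩ ?_
    rintro _ ⟨z, hz, hz0, rfl⟩
    obtain ⟨j, hj⟩ := h.exists_one_le z hz hz0
    linarith [two_mul_abs_inner_le_widthAlong_symmHull p j z]

/-- On the hull, `y j` is maximal only at `p j` and minimal only at `-p j`, with difference 2. A
sub-body of width 2 must contain all these points. -/
theorem IsFacetSystem.isLatticeReduced_symmHull [FiniteDimensional ℝ E] {L : Submodule ℤ E}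
    {J : Type*} [Finite J] [Nonempty J] {p y : J → E} (h : IsFacetSystem (dualLattice L) p y) :
    IsLatticeReduced L (symmHull p) := by
  refine ⟨h.isConvexBody_symmHull, ?_⟩
  rintro ⟨C, hC, hsub, hw⟩
  rw [h.latticeWidth_symmHull] at hw
  have hne : C.Nonempty := hC.interior_nonempty.mono interior_subset
  have key : ∀ j, p j ∈ C ∧ -p j ∈ C := by
    intro j
    have h1 := latticeWidth_le L hC.isCompact hne (h.mem j) (h.ne_zero j)
    obtain ⟨a, ha, b, hb, hab, -⟩ := exists_widthAlong_eq hC.isCompact hne (y j)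
    have hp : inner ℝ (y j) (p j) = (1 : ℝ) := by rw [real_inner_comm, h.inner_self]
    rw [hw, hab, inner_sub_right] at h1
    have ha' := h.mem_insert_of_mem_symmHull j (hsub.1 ha)
    have hb' := h.mem_insert_of_mem_symmHull j (neg_mem_symmHull_of_mem (hsub.1 hb))
    rw [inner_neg_right] at hb'
    rcases ha' with rfl | ha' <;> rcases hb' with hb' | hb'
    · exact ⟨ha, by rwa [← hb', neg_neg]⟩
    · linarith
    · rw [← neg_neg b, hb', inner_neg_right] at h1
      linarith
    · linarith
  refine hsub.2 (convexHull_min ?_ hC.convex)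
  rintro z (⟨j, rfl⟩ | ⟨j, hj⟩)
  · exact (key j).1
  · rw [← neg_neg z, ← hj]
    exact (key j).2

theorem IsFacetSystem.abs_inner_le_of_mem_widthDirections {L : Submodule ℤ E}
    {J : Type*} [Finite J] [Nonempty J] {p y : J → E} (h : IsFacetSystem (dualLattice L) p y)
    {z : E} (hz : z ∈ widthDirections L (symmHull p)) (j : J) : |inner ℝ (p j) z| ≤ (1 : ℝ) := by
  have h1 := two_mul_abs_inner_le_widthAlong_symmHull p j z
  rw [hz.2.2, h.latticeWidth_symmHull] at h1
  linarith

/-- The intersection of the slabs `{x | |⟪p j, x⟫| ≤ 1}`. -/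
def slabs {J : Type*} (p : J → E) : Set E := {x | ∀ j, |inner ℝ (p j) x| ≤ (1 : ℝ)}

theorem neg_mem_slabs {J : Type*} {p : J → E} {x : E} (hx : x ∈ slabs p) : -x ∈ slabs p := by
  intro j
  rw [inner_neg_right, abs_neg]
  exact hx j

theorem abs_inner_le_two_of_mem_sub {J : Type*} {p : J → E} {x : E} (hx : x ∈ slabs p - slabs p)
    (j : J) : |inner ℝ (p j) x| ≤ (2 : ℝ) := by
  obtain ⟨a, ha, b, hb, rfl⟩ := hx
  rw [inner_sub_right]
  exact (abs_sub _ _).trans (by linarith [ha j, hb j])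

theorem IsFacetSystem.mem_slabs {L : Submodule ℤ E} {J : Type*} {p y : J → E}
    (h : IsFacetSystem L p y) (j : J) : y j ∈ slabs p := by
  intro i
  rcases eq_or_ne i j with rfl | hij
  · rw [h.inner_self, abs_one]
  · exact (h.abs_inner_lt i j hij).le

theorem IsFacetSystem.isConvexBody_slabs [FiniteDimensional ℝ E] {L : Submodule ℤ E}
    {J : Type*} [Finite J] {p y : J → E} (h : IsFacetSystem L p y) : IsConvexBody (slabs p) := by
  have : Fintype J := Fintype.ofFinite J
  have hclosed : IsClosed (slabs p) := by
    rw [slabs, ofPred_forall]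
    exact isClosed_iInter fun j => isClosed_le (by fun_prop) continuous_const
  refine ⟨?_, ?_, ?_⟩
  · intro x hx z hz a b ha hb hab j
    rw [inner_add_right, inner_smul_right, inner_smul_right]
    refine (abs_add_le _ _).trans ?_
    rw [abs_mul, abs_mul, abs_of_nonneg ha, abs_of_nonneg hb]
    nlinarith [hx j, hz j]
  · refine Metric.isCompact_of_isClosed_isBounded hclosed ?_
    let F : E →ₗ[ℝ] (J → ℝ) := LinearMap.pi fun j => innerₛₗ ℝ (p j)
    have hF : LinearMap.ker F = ⊥ :=
      (Submodule.eq_bot_iff _).2 fun x hx => h.eq_zero x fun j => congrFun (LinearMap.mem_ker.1 hx) j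
    obtain ⟨K, -, hK⟩ := F.exists_antilipschitzWith hF
    refine (hK.isBounded_preimage (Metric.isBounded_closedBall (x := 0) (r := 1))).subset ?_
    intro x hx
    rw [mem_preimage, mem_closedBall_zero_iff, pi_norm_le_iff_of_nonneg zero_le_one]
    exact hx
  · have hopen : IsOpen {x : E | ∀ j, |inner ℝ (p j) x| < (1 : ℝ)} := by
      rw [ofPred_forall]
      exact isOpen_iInter_of_finite fun j => isOpen_lt (by fun_prop) continuous_const
    exact ⟨0, interior_maximal (fun x hx j => (hx j).le) hopen (by simp)⟩

theorem IsFacetSystem.latticeDiam_slabs [FiniteDimensional ℝ E] {L : Submodule ℤ E}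
    [DiscreteTopology L] {J : Type*} [Finite J] [Nonempty J] {p y : J → E}
    (h : IsFacetSystem L p y) : latticeDiam L (slabs p) = 2 := by
  obtain ⟨j₀⟩ := ‹Nonempty J›
  have hB := h.isConvexBody_slabs
  refine le_antisymm ?_ ?_
  · refine latticeDiam_le L zero_le_two fun v hv hv0 l hl hlv => ?_
    obtain ⟨j, hj⟩ := h.exists_one_le v hv hv0
    have h1 := abs_inner_le_two_of_mem_sub hlv j
    rw [inner_smul_right, abs_mul, abs_of_pos hl] at h1
    nlinarith
  · refine le_latticeDiam L hB.convex hB.isCompact.isBounded (h.mem j₀) (h.ne_zero j₀) two_pos ?_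
    exact ⟨y j₀, h.mem_slabs j₀, -y j₀, neg_mem_slabs (h.mem_slabs j₀),
      by simp only [sub_neg_eq_add, two_smul]⟩

/-- Adding a point `x` beyond facet `j` puts a multiple of `± y j` with factor above 1 into the
body, because `y j` is interior to the facet. Joining it to the opposite point gives length above 2.
-/
theorem IsFacetSystem.isLatticeComplete_slabs [FiniteDimensional ℝ E] {L : Submodule ℤ E}
    [DiscreteTopology L] {J : Type*} [Finite J] [Nonempty J] {p y : J → E}
    (h : IsFacetSystem L p y) : IsLatticeComplete L (slabs p) := by
  refine ⟨h.isConvexBody_slabs, ?_⟩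
  rintro ⟨C, hC, hsub, hdiam⟩
  rw [h.latticeDiam_slabs] at hdiam
  obtain ⟨x, hxC, hx⟩ := exists_of_ssubset hsub
  obtain ⟨j, hj⟩ : ∃ j, (1 : ℝ) < |inner ℝ (p j) x| := by
    by_contra! h'
    exact hx h'
  obtain ⟨q, hqL, hq0, hqS, hqj, hqi⟩ : ∃ q ∈ L, q ≠ 0 ∧ q ∈ slabs p ∧
      (inner ℝ (p j) q * inner ℝ (p j) x : ℝ) = |inner ℝ (p j) x| ∧
      ∀ i ≠ j, |inner ℝ (p i) q| < (1 : ℝ) := by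
    rcases abs_cases (inner ℝ (p j) x : ℝ) with hs | hs
    · exact ⟨y j, h.mem j, h.ne_zero j, h.mem_slabs j, by rw [h.inner_self, one_mul, hs.1],
        fun i hi => h.abs_inner_lt i j hi⟩
    · refine ⟨-y j, neg_mem (h.mem j), neg_ne_zero.2 (h.ne_zero j), neg_mem_slabs (h.mem_slabs j),
        ?_, fun i hi => ?_⟩
      · rw [inner_neg_right, h.inner_self, hs.1, neg_one_mul]
      · rw [inner_neg_right, abs_neg]
        exact h.abs_inner_lt i j hi
  set α := |inner ℝ (p j) x| - 1 with hα
  have hα0 : 0 < α := sub_pos.2 hj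
  have hqq : (inner ℝ (p j) q * inner ℝ (p j) q : ℝ) = 1 := by
    have h1 : |inner ℝ (p j) q| * |inner ℝ (p j) x| = (|inner ℝ (p j) x| : ℝ) := by
      rw [← abs_mul, hqj, abs_abs]
    rw [← abs_mul_abs_self, (mul_eq_right₀ (by linarith)).1 h1, one_mul]
  -- Step back from `q` so that mixing with `x` lands on the ray of `q`. Since `x` is at height `1 +
  -- α`, aiming at `(1 + α / 2) q` lowers constraint `j` by `t α / 2`; the other constraints are
  -- strict at `q`.
  have hev : ∀ᶠ t in 𝓝[>] (0 : ℝ), q - t • (x - (1 + α / 2) • q) ∈ slabs p := by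
    refine eventually_all.2 fun i => ?_
    have hcont : Continuous fun t : ℝ => (inner ℝ (p i) (q - t • (x - (1 + α / 2) • q)) : ℝ) := by
      fun_prop
    rcases eq_or_ne i j with rfl | hij
    · have ht : ∀ᶠ t in 𝓝[>] (0 : ℝ), t < 2 / α :=
        nhdsWithin_le_nhds (eventually_lt_nhds (by positivity))
      filter_upwards [ht, self_mem_nhdsWithin] with t ht1 (ht0 : 0 < t)
      have h1 : (inner ℝ (p i) q * inner ℝ (p i) (q - t • (x - (1 + α / 2) • q)) : ℝ)
          = 1 - t * α / 2 := by
        simp only [inner_sub_right, inner_smul_right]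
        linear_combination (1 + t * (1 + α / 2)) * hqq - t * hqj + t * hα
      have h2 : |(inner ℝ (p i) q : ℝ)| = 1 := by
        rw [← sq_eq_sq₀ (abs_nonneg _) zero_le_one, sq_abs, sq, hqq, one_pow]
      have h3 := abs_mul (inner ℝ (p i) q) (inner ℝ (p i) (q - t • (x - (1 + α / 2) • q)) : ℝ)
      rw [h2, one_mul] at h3
      rw [← h3, h1]
      rw [lt_div_iff₀ hα0] at ht1
      have : 0 < t * α := mul_pos ht0 hα0
      exact abs_le.2 ⟨by linarith, by linarith⟩
    · have ht : Tendsto (fun t : ℝ => |(inner ℝ (p i) (q - t • (x - (1 + α / 2) • q)) : ℝ)|) (𝓝 0)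
          (𝓝 |inner ℝ (p i) (q - (0 : ℝ) • (x - (1 + α / 2) • q))|) := (hcont.abs).tendsto 0
      rw [zero_smul, sub_zero] at ht
      exact nhdsWithin_le_nhds ((ht.eventually_lt_const (hqi i hij)).mono fun _ h => h.le)
  obtain ⟨t, htS, ht0⟩ := (hev.and self_mem_nhdsWithin).exists
  have ht0 : 0 < t := ht0
  have hmem := hC.convex (hsub.1 htS) hxC (a := (1 + t)⁻¹) (b := t * (1 + t)⁻¹) (by positivity)
    (by positivity) (by field_simp)
  have heq : (1 + t)⁻¹ • (q - t • (x - (1 + α / 2) • q)) + (t * (1 + t)⁻¹) • x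
      = (1 + t * α / 2 * (1 + t)⁻¹) • q := by
    match_scalars <;> field_simp <;> ring
  rw [heq] at hmem
  have h1 := le_latticeDiam L hC.convex hC.isCompact.isBounded hqL hq0
    (l := 1 + t * α / 2 * (1 + t)⁻¹ + 1) (by positivity)
    ⟨_, hmem, -q, hsub.1 (neg_mem_slabs hqS), by simp only [sub_neg_eq_add, add_smul _ (1 : ℝ), one_smul]⟩
  rw [hdiam] at h1
  have : 0 < t * α / 2 * (1 + t)⁻¹ := by positivity
  linarith

theorem IsFacetSystem.exists_of_mem_diamDirections [FiniteDimensional ℝ E] {L : Submodule ℤ E}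
    [DiscreteTopology L] {J : Type*} [Finite J] [Nonempty J] {p y : J → E}
    (h : IsFacetSystem L p y) {w : E} (hw : w ∈ diamDirections L (slabs p)) :
    ∃ v ∈ L, w ∈ span ℝ {v} ∧ ∀ j, |inner ℝ (p j) v| ≤ (1 : ℝ) := by
  obtain ⟨-, -, a, b, hab, hwab, hlen⟩ := hw
  rw [h.latticeDiam_slabs] at hlen
  obtain ⟨-, v, hv, -, hba⟩ := hlen.exists_eq_smul
  refine ⟨v, hv, ?_, fun j => ?_⟩
  · rwa [hba, span_singleton_smul_eq (IsUnit.mk0 (2 : ℝ) two_ne_zero)] at hwab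
  · have h1 := abs_inner_le_two_of_mem_sub
      (sub_mem_sub (hab (right_mem_segment ℝ a b)) (hab (left_mem_segment ℝ a b))) j
    rw [hba, inner_smul_right, abs_mul, abs_two] at h1
    linarith

end Frames

/-! ### The averaging functionals on the small coordinate block. -/

section AverageDifference

open Finset

theorem cast_card_le {ι : Type*} [Fintype ι] (S : Finset ι) : (#S : ℝ) ≤ Fintype.card ι := by
  exact_mod_cast S.card_le_univ

variable {ι : Type*} [Fintype ι] [DecidableEq ι]

/-- The average of `a` over `S` minus its average over the complement of `S`, where an additional
index at which `a` vanishes is added to the complement. -/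
noncomputable def avgDiff (S : Finset ι) (a : ι → ℝ) : ℝ :=
  (∑ i ∈ S, a i) / #S - (∑ i ∈ Sᶜ, a i) / (Fintype.card ι + 1 - #S)

theorem cast_card_compl (S : Finset ι) : (#Sᶜ : ℝ) = Fintype.card ι - #S := by
  rw [Finset.card_compl, Nat.cast_sub S.card_le_univ]

theorem avgDiff_neg (S : Finset ι) (a : ι → ℝ) : avgDiff S (-a) = -avgDiff S a := by
  simp only [avgDiff, Pi.neg_apply, Finset.sum_neg_distrib]
  ring

theorem avgDiff_indicator_self {S : Finset ι} (hS : S.Nonempty) :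
    avgDiff S (fun i => if i ∈ S then 1 else 0) = 1 := by
  have h : (#S : ℝ) ≠ 0 := by exact_mod_cast hS.card_pos.ne'
  have h1 : ∑ i ∈ S, (if i ∈ S then (1 : ℝ) else 0) = #S := by
    rw [Finset.sum_congr rfl fun i hi => if_pos hi]
    simp
  have h2 : ∑ i ∈ Sᶜ, (if i ∈ S then (1 : ℝ) else 0) = 0 :=
    Finset.sum_eq_zero fun i hi => if_neg (Finset.mem_compl.1 hi)
  rw [avgDiff, h1, h2, div_self h, zero_div, sub_zero]

/-- The extra zero index keeps the second average strictly below 1, which excludes the value -1 even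
when `T` is the complement of `S`. -/
theorem abs_avgDiff_indicator_lt {S T : Finset ι} (hS : S.Nonempty) (hST : S ≠ T) :
    |avgDiff S (fun i => if i ∈ T then 1 else 0)| < 1 := by
  have hs : (0 : ℝ) < #S := by exact_mod_cast hS.card_pos
  have hc := cast_card_le S
  have hD : (0 : ℝ) < Fintype.card ι + 1 - #S := by linarith
  rw [avgDiff, Finset.sum_boole, Finset.sum_boole]
  have hu : (#{i ∈ S | i ∈ T} : ℝ) ≤ #S := by exact_mod_cast Finset.card_filter_le _ _
  have hv : (#{i ∈ Sᶜ | i ∈ T} : ℝ) ≤ Fintype.card ι - #S := by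
    rw [← cast_card_compl]
    exact_mod_cast Finset.card_filter_le _ _
  have hu0 : 0 ≤ (#{i ∈ S | i ∈ T} : ℝ) / #S := by positivity
  have hv0 : 0 ≤ (#{i ∈ Sᶜ | i ∈ T} : ℝ) / (Fintype.card ι + 1 - #S) :=
    div_nonneg (Nat.cast_nonneg _) hD.le
  have hu1 : (#{i ∈ S | i ∈ T} : ℝ) / #S ≤ 1 := (div_le_one hs).2 hu
  have hv1 : (#{i ∈ Sᶜ | i ∈ T} : ℝ) / (Fintype.card ι + 1 - #S) < 1 :=
    (div_lt_one hD).2 (by linarith)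
  refine abs_lt.2 ⟨by linarith, ?_⟩
  by_cases hsub : S ⊆ T
  · obtain ⟨i, hiT, hiS⟩ := Finset.not_subset.1 fun h => hST (hsub.antisymm h)
    have : 0 < (#{i ∈ Sᶜ | i ∈ T} : ℝ) / (Fintype.card ι + 1 - #S) := by
      refine div_pos ?_ hD
      exact_mod_cast Finset.card_pos.2 ⟨i, by simp [hiT, hiS]⟩
    linarith
  · obtain ⟨i, hiS, hiT⟩ := Finset.not_subset.1 hsub
    have : (#{i ∈ S | i ∈ T} : ℝ) / #S < 1 := by
      refine (div_lt_one hs).2 ?_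
      exact_mod_cast Finset.card_lt_card (Finset.filter_ssubset.2 ⟨i, hiS, hiT⟩)
    linarith

/-- Take `S` to be the set where `z` is maximal. By integrality all other entries, including the
extra 0, are at least one lower, and so is their average. -/
theorem exists_one_le_avgDiff (z : ι → ℤ) {i₀ : ι} (hi₀ : 0 < z i₀) :
    ∃ S : Finset ι, S.Nonempty ∧ 1 ≤ avgDiff S (fun i => (z i : ℝ)) := by
  obtain ⟨m, -, hm⟩ := Finset.exists_max_image Finset.univ z ⟨i₀, Finset.mem_univ _⟩
  have hm1 : (1 : ℝ) ≤ z m := by exact_mod_cast hi₀.trans_le (hm i₀ (Finset.mem_univ _))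
  let S : Finset ι := {i | z i = z m}
  have hSne : S.Nonempty := ⟨m, by simp [S]⟩
  refine ⟨S, hSne, ?_⟩
  have hs : (0 : ℝ) < #S := by exact_mod_cast hSne.card_pos
  have hc := cast_card_le S
  have hD : (0 : ℝ) < Fintype.card ι + 1 - #S := by linarith
  have h1 : ∑ i ∈ S, (z i : ℝ) = #S * z m := by
    rw [Finset.sum_congr rfl fun i hi => by rw [(Finset.mem_filter.1 hi).2], Finset.sum_const,
      nsmul_eq_mul]
  have h2 : ∑ i ∈ Sᶜ, (z i : ℝ) ≤ (Fintype.card ι - #S) * (z m - 1) := by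
    rw [← cast_card_compl, ← nsmul_eq_mul]
    refine Finset.sum_le_card_nsmul _ _ _ fun i hi => ?_
    have hne : z i ≠ z m := by simpa [S] using hi
    have : z i ≤ z m - 1 := by
      have := lt_of_le_of_ne (hm i (Finset.mem_univ _)) hne
      omega
    exact_mod_cast this
  have h3 : (∑ i ∈ Sᶜ, (z i : ℝ)) / (Fintype.card ι + 1 - #S) ≤ z m - 1 := by
    rw [div_le_iff₀ hD]
    nlinarith
  rw [avgDiff, h1, mul_div_cancel_left₀ _ hs.ne']
  linarith

theorem exists_one_le_abs_avgDiff {z : ι → ℤ} (hz : z ≠ 0) :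
    ∃ S : Finset ι, S.Nonempty ∧ 1 ≤ |avgDiff S (fun i => (z i : ℝ))| := by
  obtain ⟨i, hi⟩ := Function.ne_iff.1 hz
  rcases lt_or_gt_of_ne hi with h | h
  · obtain ⟨S, hS, h1⟩ := exists_one_le_avgDiff (-z) (i₀ := i) (by simpa using h)
    refine ⟨S, hS, ?_⟩
    have h2 : (fun i => (((-z) i : ℤ) : ℝ)) = -fun i => (z i : ℝ) := by
      ext
      simp
    rw [h2, avgDiff_neg] at h1
    exact h1.trans (neg_le_abs _)
  · obtain ⟨S, hS, h1⟩ := exists_one_le_avgDiff z h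
    exact ⟨S, hS, h1.trans (le_abs_self _)⟩

/-- With `n` indices, `n · avgDiff {j} a = (n + 1) a j - ∑ a`. Summing over `j` bounds `|∑ a|` by
`n²`, hence `(n + 1) |a j| ≤ n + n²`. -/
theorem abs_le_card_of_abs_avgDiff_singleton_le {a : ι → ℝ} (h : ∀ i, |avgDiff {i} a| ≤ 1) (i : ι) :
    |a i| ≤ Fintype.card ι := by
  have hn : (1 : ℝ) ≤ Fintype.card ι := by
    exact_mod_cast Fintype.card_pos_iff.2 ⟨i⟩
  have h1 : ∀ j, Fintype.card ι * avgDiff {j} a = (Fintype.card ι + 1) * a j - ∑ i, a i := by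
    intro j
    have h2 : ∑ i ∈ ({j} : Finset ι)ᶜ, a i = ∑ i, a i - a j := by
      rw [← Finset.sum_compl_add_sum {j}, Finset.sum_singleton, add_sub_cancel_right]
    have hn0 : (Fintype.card ι : ℝ) ≠ 0 := by linarith
    rw [avgDiff, h2, Finset.sum_singleton, Finset.card_singleton, Nat.cast_one,
      add_sub_cancel_right, div_one, mul_sub, mul_div_cancel₀ _ hn0]
    ring
  have h2 : ∑ i, a i = Fintype.card ι * ∑ j, avgDiff {j} a := by
    rw [Finset.mul_sum, Finset.sum_congr rfl fun j _ => h1 j, Finset.sum_sub_distrib,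
      ← Finset.mul_sum, Finset.sum_const, Finset.card_univ, nsmul_eq_mul]
    ring
  have h3 : |∑ j, avgDiff {j} a| ≤ Fintype.card ι := by
    refine (Finset.abs_sum_le_sum_abs _ _).trans ((Finset.sum_le_card_nsmul _ _ 1 fun j _ => h j).trans ?_)
    simp
  have h4 := h1 i
  rw [h2] at h4
  obtain ⟨h5, h6⟩ := abs_le.1 h3
  obtain ⟨h7, h8⟩ := abs_le.1 (h i)
  exact abs_le.2 ⟨by nlinarith, by nlinarith⟩

theorem abs_avgDiff_le {S : Finset ι} (hS : S.Nonempty) {a : ι → ℝ} {r : ℝ} (hr : 0 ≤ r)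
    (h : ∀ i, |a i| ≤ r) : |avgDiff S a| ≤ 2 * r := by
  have hs : (0 : ℝ) < #S := by exact_mod_cast hS.card_pos
  have hc := cast_card_le S
  have hD : (0 : ℝ) < Fintype.card ι + 1 - #S := by linarith
  have hsum : ∀ T : Finset ι, |∑ i ∈ T, a i| ≤ #T * r := fun T => by
    rw [← nsmul_eq_mul]
    exact (Finset.abs_sum_le_sum_abs _ _).trans (Finset.sum_le_card_nsmul _ _ _ fun i _ => h i)
  rw [avgDiff]
  refine (abs_sub _ _).trans ?_
  rw [abs_div, abs_div, abs_of_pos hs, abs_of_pos hD, two_mul]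
  refine add_le_add ((div_le_iff₀ hs).2 (by linarith [hsum S])) ((div_le_iff₀ hD).2 ?_)
  have := hsum Sᶜ
  rw [cast_card_compl] at this
  linarith

end AverageDifference

/-! ### A facet system whose small lattice vectors span logarithmic dimension. -/

section Construction

theorem exists_injective_two_le_card {k m : ℕ} (h : k + 1 + m ≤ 2 ^ k) :
    ∃ σ : Fin m → Finset (Fin k), Function.Injective σ ∧ ∀ i, 2 ≤ (σ i).card := by
  classical
  -- The image of `g` consists of the `k + 1` subsets of size at most one.
  let g : Option (Fin k) → Finset (Fin k) := fun o => o.toFinset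
  let T : Finset (Finset (Fin k)) := (Finset.univ.image g)ᶜ
  have hT : m ≤ T.card := by
    have h1 : (Finset.univ.image g).card ≤ k + 1 := by
      refine Finset.card_image_le.trans ?_
      simp
    rw [Finset.card_compl, Fintype.card_finset, Fintype.card_fin]
    omega
  obtain ⟨f⟩ := Function.Embedding.nonempty_of_card_le (α := Fin m) (β := T) (by simpa using hT)
  refine ⟨fun i => f i, fun i j hij => f.injective (Subtype.ext hij), fun i => ?_⟩
  have hi := (f i).2
  simp only [T, Finset.mem_compl, Finset.mem_image, Finset.mem_univ, true_and, not_exists] at hi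
  by_contra! hlt
  rcases Nat.lt_succ_iff.1 hlt |>.eq_or_lt with h1 | h1
  · obtain ⟨a, ha⟩ := Finset.card_eq_one.1 h1
    exact hi (some a) (by simp [g, ha])
  · have h0 : (f i : Finset (Fin k)) = ∅ := Finset.card_eq_zero.1 (Nat.lt_one_iff.1 h1)
    exact hi none (by simp [g, h0])

variable {E : Type*} [NormedAddCommGroup E] [InnerProductSpace ℝ E] [FiniteDimensional ℝ E]

theorem exists_forall_inner_eq (f : E →ₗ[ℝ] ℝ) : ∃ p : E, ∀ x, inner ℝ p x = f x := by
  have : CompleteSpace E := FiniteDimensional.complete ℝ E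
  exact ⟨(InnerProductSpace.toDual ℝ E).symm (LinearMap.toContinuousLinearMap f), fun x => by simp⟩

theorem exists_isFacetSystem (L : Submodule ℤ E) [DiscreteTopology L] [IsZLattice ℝ L]
    (hE : 2 ≤ finrank ℝ E) : ∃ (J : Type) (_ : Finite J) (_ : Nonempty J) (p y : J → E)
      (W : Submodule ℝ E), IsFacetSystem L p y ∧ finrank ℝ W ≤ Nat.log 2 (finrank ℝ E) + 1 ∧
        ∀ z ∈ L, (∀ j, |inner ℝ (p j) z| ≤ (1 : ℝ)) → z ∈ W := by
  classical
  obtain ⟨m, hm⟩ : ∃ m, finrank ℝ E = Nat.log 2 (finrank ℝ E) + 1 + m :=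
    Nat.exists_eq_add_of_le (Nat.log_lt_self 2 (by omega))
  have hpow : finrank ℝ E < 2 ^ (Nat.log 2 (finrank ℝ E) + 1) :=
    Nat.lt_pow_succ_log_self one_lt_two _
  set k := Nat.log 2 (finrank ℝ E) + 1 with hk
  have hk1 : 1 ≤ k := Nat.le_add_left 1 _
  obtain ⟨σ, hσinj, hσ⟩ := exists_injective_two_le_card (k := k) (m := m) (by omega)
  let b : Basis (Fin k ⊕ Fin m) ℤ L :=
    (Module.finBasisOfFinrankEq ℤ L ((ZLattice.rank ℝ L).trans hm)).reindex finSumFinEquiv.symm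
  let B : Basis (Fin k ⊕ Fin m) ℝ E := b.ofZLatticeBasis ℝ L
  have hBL : ∀ i, B i ∈ L := fun i => by
    rw [Basis.ofZLatticeBasis_apply]
    exact (b i).2
  have hint : ∀ z ∈ L, ∃ c : Fin k ⊕ Fin m → ℤ, ∀ i, B.repr z i = c i := fun z hz =>
    ⟨fun i => b.repr ⟨z, hz⟩ i, fun i => by
      simpa using Basis.ofZLatticeBasis_repr_apply ℝ L b ⟨z, hz⟩ i⟩
  -- Singletons carry no extra coordinate, so they bound the block by `k` and every `avgDiff` by
  -- `2k`. The weight `2k + 2` exceeds `2k + 1`, which forces each remaining coordinate below 1.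
  let φ : Finset (Fin k) → E →ₗ[ℝ] ℝ := fun S =>
    (S.card : ℝ)⁻¹ • ∑ i ∈ S, B.coord (.inl i)
      - ((k : ℝ) + 1 - S.card)⁻¹ • ∑ i ∈ Sᶜ, B.coord (.inl i)
      + (2 * k + 2 : ℝ) • ∑ i with σ i = S, B.coord (.inr i)
  have hφ : ∀ S x, φ S x = avgDiff S (fun i => B.repr x (.inl i))
      + (2 * k + 2) * ∑ i with σ i = S, B.repr x (.inr i) := by
    intro S x
    simp [φ, avgDiff, div_eq_inv_mul, LinearMap.sum_apply]
  choose P hP using fun S => exists_forall_inner_eq (φ S)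
  let J := {S : Finset (Fin k) // S.Nonempty}
  have hbound : ∀ x, (∀ S : J, |φ S x| ≤ 1) →
      (∀ i, |B.repr x (.inl i)| ≤ k) ∧ ∀ i, |B.repr x (.inr i)| < 1 := by
    intro x hx
    have h1 : ∀ i, |B.repr x (.inl i)| ≤ k := by
      have := abs_le_card_of_abs_avgDiff_singleton_le (a := fun i => B.repr x (.inl i)) fun i => by
        have h2 := hx ⟨{i}, Finset.singleton_nonempty i⟩
        rw [hφ, Finset.filter_false_of_mem, Finset.sum_empty, mul_zero, add_zero] at h2
        · exact h2
        · rintro j - hj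
          have := hσ j
          rw [hj, Finset.card_singleton] at this
          omega
      simpa using this
    refine ⟨h1, fun i => ?_⟩
    have hne : (σ i).Nonempty := Finset.card_pos.1 (by linarith [hσ i])
    have h2 := hx ⟨σ i, hne⟩
    have h3 := abs_avgDiff_le hne (Nat.cast_nonneg k) h1
    rw [hφ, show ({j | σ j = σ i} : Finset (Fin m)) = {i} by ext j; simp [hσinj.eq_iff],
      Finset.sum_singleton] at h2
    rw [abs_le] at h2 h3
    have hk0 : (0 : ℝ) ≤ k := Nat.cast_nonneg k
    rw [abs_lt]
    constructor <;> by_contra! h4 <;> nlinarith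
  have hinr : ∀ z ∈ L, (∀ S : J, |φ S z| ≤ 1) → ∀ i, B.repr z (.inr i) = 0 := by
    intro z hz h i
    obtain ⟨c, hc⟩ := hint z hz
    have h1 := (hbound z h).2 i
    rw [hc] at h1 ⊢
    have h2 : |c (.inr i)| < 1 := by exact_mod_cast h1
    exact_mod_cast Int.abs_lt_one_iff.1 h2
  have hYl : ∀ (S : Finset (Fin k)) i, B.repr (∑ i ∈ S, B (.inl i)) (.inl i) =
      if i ∈ S then 1 else 0 := by
    intro S i
    simp [Finsupp.finsetSum_apply, Finsupp.single_apply]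
  have hYr : ∀ (S : Finset (Fin k)) i, B.repr (∑ i ∈ S, B (.inl i)) (.inr i) = 0 := by
    intro S i
    simp [Finsupp.finsetSum_apply]
  have hφY : ∀ S T : Finset (Fin k), φ S (∑ i ∈ T, B (.inl i)) =
      avgDiff S (fun i => if i ∈ T then 1 else 0) := by
    intro S T
    rw [hφ]
    simp only [hYl, hYr, Finset.sum_const_zero, mul_zero, add_zero]
  refine ⟨J, inferInstance, ⟨⟨{⟨0, hk1⟩}, Finset.singleton_nonempty _⟩⟩, fun S => P S,
    fun S => ∑ i ∈ S.1, B (.inl i), span ℝ (range fun i => B (.inl i)), ?_, ?_, ?_⟩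
  · refine ⟨fun S => sum_mem fun i _ => hBL _, fun S => ?_, fun S T hST => ?_, fun z hz hz0 => ?_,
      fun x hx => ?_⟩
    · rw [hP, hφY, avgDiff_indicator_self S.2]
    · rw [hP, hφY]
      exact abs_avgDiff_indicator_lt S.2 fun h => hST (Subtype.ext h)
    · by_contra! hlt
      simp only [hP] at hlt
      have hr := hinr z hz fun S => (hlt S).le
      obtain ⟨c, hc⟩ := hint z hz
      have hc0 : (fun i => c (.inl i)) ≠ 0 := by
        intro h0
        refine hz0 (B.ext_elem fun i => ?_)
        rcases i with i | i
        · simp [hc, show c (.inl i) = 0 from congrFun h0 i]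
        · simp [hr i]
      obtain ⟨S, hS, h1⟩ := exists_one_le_abs_avgDiff hc0
      refine absurd (hlt ⟨S, hS⟩) (not_lt.2 ?_)
      simpa [hφ, hr, hc] using h1
    · simp only [hP] at hx
      -- A common zero of all functionals has every real multiple in the unit ball, whose
      -- coordinates are bounded.
      have hzero : ∀ (r : ℝ), 0 ≤ r → ∀ i, (∀ t : ℝ, |B.repr (t • x) i| ≤ r) → B.repr x i = 0 := by
        intro r hr i h
        by_contra h0
        have := h ((r + 1) / B.repr x i)
        rw [map_smul, Finsupp.smul_apply, smul_eq_mul, div_mul_cancel₀ _ h0,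
          abs_of_pos (by linarith)] at this
        linarith
      have hx' : ∀ (t : ℝ) (S : J), |φ S (t • x)| ≤ 1 := fun t S => by simp [hx S]
      refine B.ext_elem fun i => ?_
      rw [map_zero, Finsupp.zero_apply]
      rcases i with i | i
      · exact hzero k (Nat.cast_nonneg k) _ fun t => (hbound _ (hx' t)).1 i
      · exact hzero 1 zero_le_one _ fun t => ((hbound _ (hx' t)).2 i).le
  · exact (finrank_range_le_card _).trans (by simp)
  · intro z hz h
    simp only [hP] at h
    rw [← B.sum_repr z, Fintype.sum_sum_type]
    refine add_mem (sum_mem fun i _ => smul_mem _ _ (subset_span ⟨i, rfl⟩)) (sum_mem fun i _ => ?_)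
    rw [hinr z hz h i, zero_smul]
    exact zero_mem _

end Construction

/-! ### From exponential bounds to real logarithms. -/

section Logarithms

theorem inv_log_three_mul_log_le {d n : ℕ} (hd : 1 ≤ d) (h : d ≤ 3 ^ n) :
    (Real.log 3)⁻¹ * Real.log d ≤ n := by
  have h3 : 0 < Real.log 3 := Real.log_pos (by norm_num)
  rw [inv_mul_le_iff₀ h3, mul_comm, ← Real.log_pow]
  exact Real.log_le_log (by exact_mod_cast hd) (by exact_mod_cast h)

theorem cast_le_mul_log {d n : ℕ} (hd : 2 ≤ d) (h : n ≤ Nat.log 2 d + 1) :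
    (n : ℝ) ≤ 2 / Real.log 2 * Real.log d := by
  have h2 : 0 < Real.log 2 := Real.log_pos (by norm_num)
  have h1 : (Nat.log 2 d : ℝ) * Real.log 2 ≤ Real.log d := by
    rw [← Real.log_pow]
    exact Real.log_le_log (by positivity) (by exact_mod_cast Nat.pow_log_le_self 2 (by omega))
  have h3 : Real.log 2 ≤ Real.log d := Real.log_le_log two_pos (by exact_mod_cast hd)
  have h4 : (n : ℝ) ≤ Nat.log 2 d + 1 := by exact_mod_cast h
  rw [div_mul_eq_mul_div, le_div_iff₀ h2]
  nlinarith

end Logarithms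

end LatticeBodies

theorem theorem1p2 :
    -- lower bound for lattice reduced bodies
    (∃ c : ℝ, 0 < c ∧ ∀ d : ℕ, 1 ≤ d →
      ∀ (Λ : Submodule ℤ (EuclideanSpace ℝ (Fin d))) [DiscreteTopology Λ] [IsZLattice ℝ Λ]
        (C : Set (EuclideanSpace ℝ (Fin d))), LatticeBodies.IsLatticeReduced Λ C →
        c * Real.log d ≤
          Module.finrank ℝ (Submodule.span ℝ (LatticeBodies.widthDirections Λ C))) ∧
    -- lower bound for lattice complete bodies
    (∃ c : ℝ, 0 < c ∧ ∀ d : ℕ, 1 ≤ d →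
      ∀ (Λ : Submodule ℤ (EuclideanSpace ℝ (Fin d))) [DiscreteTopology Λ] [IsZLattice ℝ Λ]
        (C : Set (EuclideanSpace ℝ (Fin d))), LatticeBodies.IsLatticeComplete Λ C →
        c * Real.log d ≤
          Module.finrank ℝ (Submodule.span ℝ (LatticeBodies.diamDirections Λ C))) ∧
    -- the order of magnitude is optimal for lattice reduced bodies
    (∃ K : ℝ, 0 < K ∧ ∀ d : ℕ, 2 ≤ d →
      ∀ (Λ : Submodule ℤ (EuclideanSpace ℝ (Fin d))) [DiscreteTopology Λ] [IsZLattice ℝ Λ],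
        ∃ C : Set (EuclideanSpace ℝ (Fin d)), LatticeBodies.IsLatticeReduced Λ C ∧
          Module.finrank ℝ (Submodule.span ℝ (LatticeBodies.widthDirections Λ C)) ≤
            K * Real.log d) ∧
    -- the order of magnitude is optimal for lattice complete bodies
    (∃ K : ℝ, 0 < K ∧ ∀ d : ℕ, 2 ≤ d →
      ∀ (Λ : Submodule ℤ (EuclideanSpace ℝ (Fin d))) [DiscreteTopology Λ] [IsZLattice ℝ Λ],
        ∃ C : Set (EuclideanSpace ℝ (Fin d)), LatticeBodies.IsLatticeComplete Λ C ∧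
          Module.finrank ℝ (Submodule.span ℝ (LatticeBodies.diamDirections Λ C)) ≤
            K * Real.log d) := by
  have finrank_eq (d : ℕ) : Module.finrank ℝ (EuclideanSpace ℝ (Fin d)) = d := by simp
  refine ⟨⟨(Real.log 3)⁻¹, inv_pos.2 (Real.log_pos (by norm_num)), fun d hd Λ _ _ C hC => ?_⟩,
    ⟨(Real.log 3)⁻¹, inv_pos.2 (Real.log_pos (by norm_num)), fun d hd Λ _ _ C hC => ?_⟩,
    ⟨2 / Real.log 2, div_pos two_pos (Real.log_pos (by norm_num)), fun d hd Λ _ _ => ?_⟩,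
    ⟨2 / Real.log 2, div_pos two_pos (Real.log_pos (by norm_num)), fun d hd Λ _ _ => ?_⟩⟩
  · have h := hC.finrank_le_three_pow Λ (by rwa [finrank_eq])
    rw [finrank_eq] at h
    exact LatticeBodies.inv_log_three_mul_log_le hd h
  · have h := hC.finrank_le_three_pow Λ (by rwa [finrank_eq])
    rw [finrank_eq] at h
    exact LatticeBodies.inv_log_three_mul_log_le hd h
  · have := LatticeBodies.discreteTopology_dualLattice Λ
    have : IsZLattice ℝ (LatticeBodies.dualLattice Λ) := ⟨LatticeBodies.span_dualLattice Λ⟩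
    obtain ⟨J, _, _, p, y, W, h, hW, hmem⟩ :=
      LatticeBodies.exists_isFacetSystem (LatticeBodies.dualLattice Λ) (by rwa [finrank_eq])
    rw [finrank_eq] at hW
    refine ⟨LatticeBodies.symmHull p, h.isLatticeReduced_symmHull,
      LatticeBodies.cast_le_mul_log hd ((Submodule.finrank_mono (Submodule.span_le.2 ?_)).trans hW)⟩
    exact fun z hz => hmem z hz.1 fun j => h.abs_inner_le_of_mem_widthDirections hz j
  · obtain ⟨J, _, _, p, y, W, h, hW, hmem⟩ :=
      LatticeBodies.exists_isFacetSystem Λ (by rwa [finrank_eq])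
    rw [finrank_eq] at hW
    refine ⟨LatticeBodies.slabs p, h.isLatticeComplete_slabs,
      LatticeBodies.cast_le_mul_log hd ((Submodule.finrank_mono (Submodule.span_le.2 ?_)).trans hW)⟩
    intro w hw
    obtain ⟨v, hv, hwv, hle⟩ := h.exists_of_mem_diamDirections hw
    exact (Submodule.span_singleton_le_iff_mem _ _).2 (hmem v hv hle) hwv
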